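/- Let $N\ge 5$ be an integer, $\sigma>-4$ a real number, $\Omega_e=\{x\in\mathbb R^N: |x|>1\}$, $\overline{\Omega_e}=\{x\in\mathbb R^N:|x|\ge 1\}$, $\partial B_1=\{|x|=1\}$, and $$\mu^*=\Big(\frac{N(N-4)}4\Big)^2,\qquad \mu_N=\frac{N-4}{2}+\sqrt{\Big(\frac{N-2}{2}\Big)^2+1-\sqrt{(N-2)^2+\mu}}\qquad(0<\mu\le\mu^*).$$ Consider the problem $$(E)\qquad \Delta^2u-\frac{\mu}{|x|^4}u=|x|^\sigma|u|^p+f(x)\ \text{ in }\Omega_e,\qquad u=\Delta u=0\ \text{ on }\partial B_1 .$$ A weak solution of $(E)$ is a function $u\in L^p_{\rm loc}(\overline{\Omega_e})$ such that $$\int_{\Omega_e}|x|^\sigma|u|^p\varphi\,dx+\int_{\Omega_e}f\varphi\,dx=\int_{\Omega_e}u\Big(\Delta^2\varphi-\frac{\mu}{|x|^4}\varphi\Big)dx$$ for every nonnegative $\varphi\in C^4(\overline{\Omega_e})$ with compact support in $\overline{\Omega_e}$ and $\varphi=\Delta\varphi=0$ on $\partial B_1$. A smooth solution of $(E)$ is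 a function $u\in C^\infty(\overline{\Omega_e})$ that satisfies the equation pointwise in $\Omega_e$ and the boundary conditions pointwise on $\partial B_1$. (i) Assume that either $$0<\mu\le\mu^*,\quad 1<p<1+\frac{\sigma+4}{\mu_N},\qquad\text{or}\qquad 0<\mu<\mu^*,\quad p=1+\frac{\sigma+4}{\mu_N}.$$ Then, for every (almost everywhere) positive function $f\in L^1_{\rm loc}(\overline{\Omega_e})$, problem $(E)$ admits no weak solution. (ii) If $0<\mu\le\mu^*$ and $p>1+\frac{\sigma+4}{\mu_N}$, then there is a function $f\in L^1_{\rm loc}(\overline{\Omega_e})$, positive everywhere in $\Omega_e$, for which problem $(E)$ admits a smooth solution $u\in C^\infty(\overline{\Omega_e})$. -/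

import Mathlib

open Set MeasureTheory
open scoped ContDiff Laplacian InnerProductSpace

noncomputable section

/-- The exterior domain `Ω_e = ℝ^N ∖ closure B₁`. -/
def exteriorDomain (N : ℕ) : Set (EuclideanSpace ℝ (Fin N)) := {x | 1 < ‖x‖}

/-- The closure `ℝ^N ∖ B₁` of the exterior domain (see `closure_exteriorDomain`). -/
def closedExteriorDomain (N : ℕ) : Set (EuclideanSpace ℝ (Fin N)) := {x | 1 ≤ ‖x‖}

theorem closure_exteriorDomain {N : ℕ} (hN : 0 < N) :
    closure (exteriorDomain N) = closedExteriorDomain N := by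
  have _ne : Nonempty (Fin N) := ⟨⟨0, hN⟩⟩
  have h : exteriorDomain N = (Metric.closedBall (0 : EuclideanSpace ℝ (Fin N)) 1)ᶜ := by
    ext x; simp [exteriorDomain]
  rw [h, closure_compl, interior_closedBall _ one_ne_zero]
  ext x; simp [closedExteriorDomain]

/-- The Hardy–Rellich constant `μ* = (N (N - 4) / 4)²`. -/
def hardyRellichConst (N : ℕ) : ℝ := ((N : ℝ) * ((N : ℝ) - 4) / 4) ^ 2

/-- The parameter `μ_N`. -/
def muN (N : ℕ) (μ : ℝ) : ℝ :=
  ((N : ℝ) - 4) / 2 +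
    √((((N : ℝ) - 2) / 2) ^ 2 + 1 - √(((N : ℝ) - 2) ^ 2 + μ))

/-- The unit sphere `∂B₁` carries the Navier conditions `v = Δ v = 0`; the Laplacian at a boundary
point is computed with the derivatives within the closed exterior domain, since `v` is only
considered there. -/
def NavierBoundary {N : ℕ} (v : EuclideanSpace ℝ (Fin N) → ℝ) : Prop :=
  ∀ x : EuclideanSpace ℝ (Fin N), ‖x‖ = 1 →
    v x = 0 ∧ (Δ[closedExteriorDomain N] v) x = 0

/-- Test functions for the elliptic problem: nonnegative, of class `C⁴` up to the boundary, with
compact support in the closed exterior domain, and with `φ = Δ φ = 0` on `∂B₁`. The values of `φ`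
inside the unit ball play no role. -/
structure IsTestFunction {N : ℕ} (φ : EuclideanSpace ℝ (Fin N) → ℝ) : Prop where
  contDiffOn : ContDiffOn ℝ 4 φ (closedExteriorDomain N)
  compactSupport : ∃ K : Set (EuclideanSpace ℝ (Fin N)), IsCompact K ∧
    K ⊆ closedExteriorDomain N ∧ ∀ x ∈ closedExteriorDomain N, x ∉ K → φ x = 0
  nonneg : ∀ x ∈ closedExteriorDomain N, 0 ≤ φ x
  navier : NavierBoundary φ

/-- Weak solutions `u ∈ L^p_loc` (up to the boundary) of
`Δ² u - μ |x|⁻⁴ u = |x|^σ |u|^p + f` in `Ω_e`, `u = Δ u = 0` on `∂B₁`. -/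
structure IsWeakSolution {N : ℕ} (μ σ p : ℝ) (f u : EuclideanSpace ℝ (Fin N) → ℝ) : Prop where
  memLp_loc : ∀ K : Set (EuclideanSpace ℝ (Fin N)), IsCompact K → K ⊆ closedExteriorDomain N →
    MemLp u (ENNReal.ofReal p) (volume.restrict K)
  weak_eq : ∀ φ : EuclideanSpace ℝ (Fin N) → ℝ, IsTestFunction φ →
    (∫ x in exteriorDomain N, ‖x‖ ^ σ * |u x| ^ p * φ x) + (∫ x in exteriorDomain N, f x * φ x)
      = ∫ x in exteriorDomain N, u x * ((Δ (Δ φ)) x - μ / ‖x‖ ^ 4 * φ x)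

/-- Solutions `u ∈ C^∞` (up to the boundary) of
`Δ² u - μ |x|⁻⁴ u = |x|^σ |u|^p + f` in `Ω_e`, `u = Δ u = 0` on `∂B₁`. -/
structure IsSmoothSolution {N : ℕ} (μ σ p : ℝ) (f u : EuclideanSpace ℝ (Fin N) → ℝ) : Prop where
  contDiffOn : ContDiffOn ℝ ∞ u (closedExteriorDomain N)
  equation : ∀ x ∈ exteriorDomain N,
    (Δ (Δ u)) x - μ / ‖x‖ ^ 4 * u x = ‖x‖ ^ σ * |u x| ^ p + f x
  navier : NavierBoundary u

end

/-! Put a = (N - 4)/2, b = N/2 and t = log ‖x‖. On functions ‖x‖^(-a) w(t) the bilaplacian acts, up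
to the factor ‖x‖^(-(a+4)), as (D² - a²)(D² - b²). Subtracting μ leaves the exponents ±s₁, ±s₂ with
0 ≤ s₁ < a, b < s₂, and μ_N = a + s₁. Both halves then reduce to combinations of exponentials in t.

Nonexistence: a homogeneous solution g > 0 satisfying the Navier conditions and growing like
exp(s₁t) (`IsNavierKernel`) is truncated on τ ≤ t ≤ τ + 1 and used as test function. The operator
then only sees this shell, and Hölder's inequality there (`exists_source_mul_profile_estimate`)
gives I(τ) + F ≤ M b(τ)^(1/p). Here I is the tested source, b its part on the shell, F > 0 a lower
bound for the tested f, and M is independent of τ exactly because p is at most critical. Since b ≤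
I, the integral I stays bounded; since b ≥ (F/M)^p on every shell, summing over disjoint shells
makes I unbounded. This contradiction includes the critical exponent. At μ = μ* the root s₁ = 0 is
double and g grows linearly, which costs an arbitrarily small power, so p must be strictly
subcritical.

Existence: a small multiple of a Navier profile decaying like exp(-s₁t) has a residual that is a
positive multiple of exp(-kt), with k slightly above s₁. For supercritical p this dominates the
source term, and f is defined as the difference. -/

/-! ### Radial functions in the logarithmic variable -/

/-- The radial function `x ↦ ‖x‖ ^ (-c) * w (log ‖x‖)`. -/
noncomputable def radialProfile {E : Type*} [Norm E] (c : ℝ) (w : ℝ → ℝ) (x : E) : ℝ :=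
  ‖x‖ ^ (-c) * w (Real.log ‖x‖)

/-- The first-order operator `d/dt - l`. -/
noncomputable def shiftDeriv (l : ℝ) (w : ℝ → ℝ) (t : ℝ) : ℝ := deriv w t - l * w t

theorem ContDiff.shiftDeriv {w : ℝ → ℝ} (hw : ContDiff ℝ ∞ w) (l : ℝ) :
    ContDiff ℝ ∞ (shiftDeriv l w) :=
  (contDiff_infty_iff_deriv.1 hw).2.sub (contDiff_const.mul hw)

section Radial

variable {E : Type*} [NormedAddCommGroup E] [InnerProductSpace ℝ E]

theorem contDiffAt_radialProfile (c : ℝ) {w : ℝ → ℝ} (hw : ContDiff ℝ ∞ w) {x : E} (hx : x ≠ 0) :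
    ContDiffAt ℝ ∞ (radialProfile c w) x := by
  have h0 : ‖x‖ ≠ 0 := norm_ne_zero_iff.2 hx
  have hn : ContDiffAt ℝ ∞ (fun y : E => ‖y‖) x := contDiffAt_norm ℝ hx
  exact (hn.rpow_const_of_ne h0).mul (hw.contDiffAt.comp x (hn.log h0))

theorem hasFDerivAt_radialProfile (c : ℝ) {w : ℝ → ℝ} (hw : Differentiable ℝ w) {x : E}
    (hx : x ≠ 0) :
    HasFDerivAt (radialProfile c w)
      (radialProfile (c + 2) (shiftDeriv c w) x • innerSL ℝ x) x := by
  have h0 : 0 < ‖x‖ := norm_pos_iff.2 hx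
  have hsq : HasFDerivAt (fun y : E => ‖y‖ ^ 2) (2 • innerSL ℝ x) x :=
    (hasStrictFDerivAt_norm_sq x).hasFDerivAt
  have hnorm : HasFDerivAt (fun y : E => ‖y‖) (‖x‖⁻¹ • innerSL ℝ x) x := by
    have h := hsq.sqrt (pow_ne_zero 2 h0.ne')
    simp only [Real.sqrt_sq (norm_nonneg _)] at h
    convert h using 1
    ext v
    simp
    field_simp
  have hprof : HasDerivAt (fun r : ℝ => r ^ (-c) * w (Real.log r))
      ((-c) * ‖x‖ ^ (-c - 1) * w (Real.log ‖x‖) +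
        ‖x‖ ^ (-c) * (deriv w (Real.log ‖x‖) * ‖x‖⁻¹)) ‖x‖ :=
    (Real.hasDerivAt_rpow_const (Or.inl h0.ne')).mul
      ((hw _).hasDerivAt.comp ‖x‖ (Real.hasDerivAt_log h0.ne'))
  have h := hprof.comp_hasFDerivAt x hnorm
  refine h.congr_fderiv ?_
  ext v
  have e1 : ‖x‖ ^ (-c - 1) = ‖x‖ ^ (-c) * ‖x‖⁻¹ := by
    rw [Real.rpow_sub_one h0.ne', div_eq_mul_inv]
  have e2 : ‖x‖ ^ (-(c + 2)) = ‖x‖ ^ (-c) * (‖x‖⁻¹ * ‖x‖⁻¹) := by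
    rw [neg_add, Real.rpow_add h0, Real.rpow_neg h0.le 2, Real.rpow_two, sq, mul_inv]
  simp only [radialProfile, shiftDeriv, e1, e2, smul_apply, smul_eq_mul]
  ring

theorem fderiv_radialProfile_eventuallyEq (c : ℝ) {w : ℝ → ℝ} (hw : Differentiable ℝ w) {x : E}
    (hx : x ≠ 0) :
    fderiv ℝ (radialProfile c w) =ᶠ[nhds x]
      fun y : E => radialProfile (c + 2) (shiftDeriv c w) y • innerSL ℝ y := by
  filter_upwards [isOpen_ne.mem_nhds hx] with y hy
  exact (hasFDerivAt_radialProfile c hw hy).fderiv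

theorem iteratedFDeriv_two_radialProfile (c : ℝ) {w : ℝ → ℝ} (hw : ContDiff ℝ ∞ w) {x : E}
    (hx : x ≠ 0) (v : E) :
    iteratedFDeriv ℝ 2 (radialProfile c w) x ![v, v] =
      radialProfile (c + 4) (shiftDeriv (c + 2) (shiftDeriv c w)) x * ⟪x, v⟫_ℝ ^ 2 +
        radialProfile (c + 2) (shiftDeriv c w) x * ‖v‖ ^ 2 := by
  have hd := (hw.shiftDeriv c).differentiable (by simp)
  rw [iteratedFDeriv_two_apply,
    (fderiv_radialProfile_eventuallyEq c (hw.differentiable (by simp)) hx).fderiv_eq,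
    HasFDerivAt.fderiv (f := fun y : E => radialProfile (c + 2) (shiftDeriv c w) y • innerSL ℝ y)
      ((hasFDerivAt_radialProfile (c + 2) hd hx).smul (innerSL ℝ (E := E)).hasFDerivAt)]
  rw [show c + 2 + 2 = c + 4 by ring]
  have hv : (innerSL ℝ v) v = ‖v‖ ^ 2 := real_inner_self_eq_norm_sq v
  simp [hv]
  ring

/-- In the trace of the Hessian, ∑ ⟪x, eᵢ⟫² = ‖x‖² restores the power -(c + 2), and the N copies of
the first-order term turn the shift c + 2 into c + 2 - N. -/
theorem laplacian_radialProfile [FiniteDimensional ℝ E] (c : ℝ) {w : ℝ → ℝ}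
    (hw : ContDiff ℝ ∞ w) {x : E} (hx : x ≠ 0) :
    Δ (radialProfile c w : E → ℝ) x =
      radialProfile (c + 2)
        (shiftDeriv (c + 2 - Module.finrank ℝ E) (shiftDeriv c w)) x := by
  have h0 : 0 < ‖x‖ := norm_pos_iff.2 hx
  rw [InnerProductSpace.laplacian_eq_iteratedFDeriv_stdOrthonormalBasis]
  simp only [iteratedFDeriv_two_radialProfile c hw hx, Finset.sum_add_distrib,
    ← Finset.mul_sum]
  have e1 : ∑ i, ⟪x, stdOrthonormalBasis ℝ E i⟫_ℝ ^ 2 = ‖x‖ ^ 2 := by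
    have := (stdOrthonormalBasis ℝ E).sum_sq_norm_inner_left x
    simpa using this
  have e2 : ‖x‖ ^ (-(c + 4)) * ‖x‖ ^ 2 = ‖x‖ ^ (-(c + 2)) := by
    rw [← Real.rpow_natCast, ← Real.rpow_add h0]
    norm_num
    ring_nf
  rw [e1]
  simp only [radialProfile, shiftDeriv, OrthonormalBasis.norm_eq_one, one_pow, Finset.sum_const,
    Finset.card_univ, Fintype.card_fin, nsmul_eq_mul, mul_one]
  rw [mul_right_comm, e2]
  ring

theorem laplacian_laplacian_radialProfile [FiniteDimensional ℝ E] (c : ℝ) {w : ℝ → ℝ}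
    (hw : ContDiff ℝ ∞ w) {x : E} (hx : x ≠ 0) :
    Δ (Δ (radialProfile c w : E → ℝ)) x =
      radialProfile (c + 4)
        (shiftDeriv (c + 4 - Module.finrank ℝ E) (shiftDeriv (c + 2)
          (shiftDeriv (c + 2 - Module.finrank ℝ E) (shiftDeriv c w)))) x := by
  have h : Δ (radialProfile c w : E → ℝ) =ᶠ[nhds x] radialProfile (c + 2)
      (shiftDeriv (c + 2 - Module.finrank ℝ E) (shiftDeriv c w)) := by
    filter_upwards [isOpen_ne.mem_nhds hx] with y hy
    exact laplacian_radialProfile c hw hy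
  rw [(InnerProductSpace.laplacian_congr_nhds h).self_of_nhds,
    laplacian_radialProfile (c + 2) ((hw.shiftDeriv _).shiftDeriv _) hx]
  ring_nf

end Radial

/-! ### The exterior domain and the Laplacian at its boundary -/

theorem mem_exteriorDomain {N : ℕ} {x : EuclideanSpace ℝ (Fin N)} :
    x ∈ exteriorDomain N ↔ 1 < ‖x‖ := Iff.rfl

theorem mem_closedExteriorDomain {N : ℕ} {x : EuclideanSpace ℝ (Fin N)} :
    x ∈ closedExteriorDomain N ↔ 1 ≤ ‖x‖ := Iff.rfl

theorem ne_zero_of_mem_closedExteriorDomain {N : ℕ} {x : EuclideanSpace ℝ (Fin N)}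
    (hx : x ∈ closedExteriorDomain N) : x ≠ 0 := by
  rintro rfl
  simp [closedExteriorDomain] at hx
  linarith

theorem exteriorDomain_subset_closedExteriorDomain (N : ℕ) :
    exteriorDomain N ⊆ closedExteriorDomain N :=
  fun _ hx => mem_closedExteriorDomain.2 (mem_exteriorDomain.1 hx).le

theorem isClosed_closedExteriorDomain (N : ℕ) : IsClosed (closedExteriorDomain N) :=
  isClosed_le continuous_const continuous_norm

theorem isOpen_exteriorDomain (N : ℕ) : IsOpen (exteriorDomain N) :=
  isOpen_lt continuous_const continuous_norm

/-- The domain is not convex, but by Cauchy–Schwarz it contains the half-space ‖x‖ ≤ ⟪x, y⟫, which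
in turn contains x whenever ‖x‖ ≥ 1. -/
theorem uniqueDiffOn_closedExteriorDomain (N : ℕ) : UniqueDiffOn ℝ (closedExteriorDomain N) := by
  intro x hx
  have hx1 : 1 ≤ ‖x‖ := hx
  have h0 : 0 < ‖x‖ := by linarith
  let H : Set (EuclideanSpace ℝ (Fin N)) := {y | ‖x‖ ≤ innerSL ℝ x y}
  have hconv : Convex ℝ H := convex_halfSpace_ge (innerSL ℝ x).isLinear _
  have hxH : x ∈ H := by
    simp only [H, mem_ofPred_eq, innerSL_apply_apply, real_inner_self_eq_norm_sq]
    nlinarith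
  have hint : (interior H).Nonempty := by
    refine ⟨(2 : ℝ) • x, mem_interior.2 ⟨{y | ‖x‖ < innerSL ℝ x y},
      fun y (hy : ‖x‖ < innerSL ℝ x y) => hy.le,
      isOpen_lt continuous_const (innerSL ℝ x).continuous, ?_⟩⟩
    simp only [mem_ofPred_eq, innerSL_apply_apply, inner_smul_right, real_inner_self_eq_norm_sq]
    nlinarith
  refine (uniqueDiffWithinAt_convex hconv hint (subset_closure hxH)).mono fun y hy => ?_
  have h1 : ‖x‖ ≤ ⟪x, y⟫_ℝ := hy
  have h2 := real_inner_le_norm x y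
  show 1 ≤ ‖y‖
  nlinarith

theorem laplacianWithin_closedExteriorDomain {N : ℕ} {v : EuclideanSpace ℝ (Fin N) → ℝ}
    {x : EuclideanSpace ℝ (Fin N)} (hv : ContDiffAt ℝ 2 v x) (hx : x ∈ closedExteriorDomain N) :
    (Δ[closedExteriorDomain N] v) x = (Δ v) x := by
  rw [InnerProductSpace.laplacianWithin_eq_iteratedFDerivWithin_stdOrthonormalBasis _
    (uniqueDiffOn_closedExteriorDomain N) hx,
    InnerProductSpace.laplacian_eq_iteratedFDeriv_stdOrthonormalBasis]
  simp only
  rw [iteratedFDerivWithin_eq_iteratedFDeriv (uniqueDiffOn_closedExteriorDomain N) hv hx]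

theorem navierBoundary_radialProfile {N : ℕ} (c : ℝ) {w : ℝ → ℝ} (hw : ContDiff ℝ ∞ w)
    (h0 : w 0 = 0) (h2 : shiftDeriv (c + 2 - N) (shiftDeriv c w) 0 = 0) :
    NavierBoundary (radialProfile c w : EuclideanSpace ℝ (Fin N) → ℝ) := by
  intro x hx
  have hx' : x ∈ closedExteriorDomain N := hx.ge
  have hne := ne_zero_of_mem_closedExteriorDomain hx'
  refine ⟨by simp [radialProfile, hx, h0], ?_⟩
  rw [laplacianWithin_closedExteriorDomain
    ((contDiffAt_radialProfile c hw hne).of_le ENat.LEInfty.out) hx',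
    laplacian_radialProfile c hw hne]
  simp [radialProfile, hx, h2]

theorem contDiffOn_radialProfile {N : ℕ} (c : ℝ) {w : ℝ → ℝ} (hw : ContDiff ℝ ∞ w) :
    ContDiffOn ℝ ∞ (radialProfile c w : EuclideanSpace ℝ (Fin N) → ℝ) (closedExteriorDomain N) :=
  fun _ hx => (contDiffAt_radialProfile c hw
    (ne_zero_of_mem_closedExteriorDomain hx)).contDiffWithinAt

/-! ### Indicial roots -/

/-- The roots `s₁ < s₂` (up to sign) of `(s² - a²)(s² - b²) = μ`, with `a = (N - 4) / 2` and
`b = N / 2`. -/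
structure IsIndicialPair (a b μ s₁ s₂ : ℝ) : Prop where
  a_pos : 0 < a
  b_eq : b = a + 2
  s₁_nonneg : 0 ≤ s₁
  s₁_lt : s₁ < a
  lt_s₂ : b < s₂
  sum_sq : s₁ ^ 2 + s₂ ^ 2 = a ^ 2 + b ^ 2
  prod_sq : s₁ ^ 2 * s₂ ^ 2 = a ^ 2 * b ^ 2 - μ

/-- The indicial equation is quadratic in s², with roots m ± D, where m = (a² + b²)/2 = ((N - 2)/2)²
+ 1 and D = √((N - 2)² + μ). As a² = m - (N - 2) and b² = m + (N - 2), positivity of μ places the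
roots outside [a², b²]; μ ≤ μ* means D ≤ m. -/
theorem exists_isIndicialPair {N : ℕ} (hN : 5 ≤ N) {μ : ℝ} (h0 : 0 < μ)
    (h1 : μ ≤ hardyRellichConst N) :
    ∃ s₁ s₂, IsIndicialPair (((N : ℝ) - 4) / 2) ((N : ℝ) / 2) μ s₁ s₂ ∧
      muN N μ = ((N : ℝ) - 4) / 2 + s₁ ∧ (μ < hardyRellichConst N → 0 < s₁) := by
  have hN' : (5 : ℝ) ≤ N := by exact_mod_cast hN
  set n : ℝ := (N : ℝ) with hn
  set D := √((n - 2) ^ 2 + μ) with hD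
  have hD2 : D ^ 2 = (n - 2) ^ 2 + μ := Real.sq_sqrt (by positivity)
  have hD0 : 0 ≤ D := Real.sqrt_nonneg _
  have hDlow : n - 2 < D := Real.lt_sqrt_of_sq_lt (by linarith)
  have hM : 0 ≤ ((n - 2) / 2) ^ 2 + 1 := by positivity
  have key : (((n - 2) / 2) ^ 2 + 1) ^ 2 = (n - 2) ^ 2 + hardyRellichConst N := by
    simp only [hardyRellichConst, ← hn]
    ring
  have hle : D ≤ ((n - 2) / 2) ^ 2 + 1 :=
    le_of_sq_le_sq (by linarith) hM
  have hS1 : √(((n - 2) / 2) ^ 2 + 1 - D) ^ 2 = ((n - 2) / 2) ^ 2 + 1 - D :=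
    Real.sq_sqrt (by linarith)
  have hS2 : √(((n - 2) / 2) ^ 2 + 1 + D) ^ 2 = ((n - 2) / 2) ^ 2 + 1 + D :=
    Real.sq_sqrt (by linarith)
  refine ⟨√(((n - 2) / 2) ^ 2 + 1 - D), √(((n - 2) / 2) ^ 2 + 1 + D),
    ⟨by linarith, by ring, Real.sqrt_nonneg _, ?_, ?_, ?_, ?_⟩, rfl, fun h => ?_⟩
  · rw [Real.sqrt_lt' (by linarith)]
    nlinarith
  · apply Real.lt_sqrt_of_sq_lt
    nlinarith
  · rw [hS1, hS2]
    ring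
  · rw [hS1, hS2]
    simp only [hardyRellichConst, ← hn] at key
    linear_combination key - hD2
  · apply Real.sqrt_pos.2
    have : D < ((n - 2) / 2) ^ 2 + 1 := by
      apply lt_of_pow_lt_pow_left₀ 2 hM
      linarith
    linarith

/-! ### The Emden–Fowler operator on exponentials -/

/-- The operator `(D² - a²)(D² - b²)`, `D = d/dt`, in factored form. -/
noncomputable def emdenFowlerOp (a b : ℝ) (w : ℝ → ℝ) : ℝ → ℝ :=
  shiftDeriv (-a) (shiftDeriv b (shiftDeriv (-b) (shiftDeriv a w)))

/-- With c = (N - 4)/2 the four shifts become a, -b, b, -a, so the symbol is even. -/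
theorem laplacian_laplacian_radialProfile_eq {N : ℕ} {w : ℝ → ℝ} (hw : ContDiff ℝ ∞ w)
    {x : EuclideanSpace ℝ (Fin N)} (hx : x ≠ 0) :
    Δ (Δ (radialProfile (((N : ℝ) - 4) / 2) w : EuclideanSpace ℝ (Fin N) → ℝ)) x =
      radialProfile (((N : ℝ) - 4) / 2 + 4) (emdenFowlerOp (((N : ℝ) - 4) / 2) (N / 2) w) x := by
  rw [laplacian_laplacian_radialProfile _ hw hx, emdenFowlerOp]
  simp only [finrank_euclideanSpace, Fintype.card_fin]
  ring_nf

theorem navierBoundary_radialProfile_eq {N : ℕ} {w : ℝ → ℝ} (hw : ContDiff ℝ ∞ w)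
    (h0 : w 0 = 0) (h2 : shiftDeriv (-(N / 2)) (shiftDeriv (((N : ℝ) - 4) / 2) w) 0 = 0) :
    NavierBoundary
      (radialProfile (((N : ℝ) - 4) / 2) w : EuclideanSpace ℝ (Fin N) → ℝ) := by
  refine navierBoundary_radialProfile _ hw h0 ?_
  convert h2 using 2
  ring

theorem radialProfile_add_four {N : ℕ} (a : ℝ) (w : ℝ → ℝ) {x : EuclideanSpace ℝ (Fin N)}
    (hx : x ≠ 0) :
    radialProfile (a + 4) w x = 1 / ‖x‖ ^ 4 * radialProfile a w x := by
  have h0 : 0 < ‖x‖ := norm_pos_iff.2 hx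
  simp only [radialProfile]
  rw [neg_add, Real.rpow_add h0, Real.rpow_neg h0.le 4]
  norm_num
  ring

theorem hasDerivAt_exp_mul (k t : ℝ) :
    HasDerivAt (fun t => Real.exp (k * t)) (k * Real.exp (k * t)) t := by
  have h := ((hasDerivAt_id t).const_mul k).exp
  simp only [id, mul_one] at h
  rwa [mul_comm] at h

/-- A linear combination of three exponentials. -/
noncomputable def threeExp (k₁ k₂ k₃ A B C t : ℝ) : ℝ :=
  A * Real.exp (k₁ * t) + B * Real.exp (k₂ * t) + C * Real.exp (k₃ * t)

theorem contDiff_threeExp (k₁ k₂ k₃ A B C : ℝ) :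
    ContDiff ℝ ∞ (threeExp k₁ k₂ k₃ A B C) := by
  unfold threeExp
  fun_prop

theorem deriv_threeExp (k₁ k₂ k₃ A B C : ℝ) :
    deriv (threeExp k₁ k₂ k₃ A B C) = threeExp k₁ k₂ k₃ (A * k₁) (B * k₂) (C * k₃) := by
  funext t
  have h := (((hasDerivAt_exp_mul k₁ t).const_mul A).add
    ((hasDerivAt_exp_mul k₂ t).const_mul B)).add ((hasDerivAt_exp_mul k₃ t).const_mul C)
  refine (HasDerivAt.deriv (f := threeExp k₁ k₂ k₃ A B C) h).trans ?_
  simp only [threeExp]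
  ring

theorem shiftDeriv_threeExp (l k₁ k₂ k₃ A B C : ℝ) :
    shiftDeriv l (threeExp k₁ k₂ k₃ A B C) =
      threeExp k₁ k₂ k₃ (A * (k₁ - l)) (B * (k₂ - l)) (C * (k₃ - l)) := by
  funext t
  simp only [shiftDeriv, deriv_threeExp, threeExp]
  ring

theorem emdenFowlerOp_threeExp (a b k₁ k₂ k₃ A B C : ℝ) :
    emdenFowlerOp a b (threeExp k₁ k₂ k₃ A B C) =
      threeExp k₁ k₂ k₃ (A * ((k₁ ^ 2 - a ^ 2) * (k₁ ^ 2 - b ^ 2)))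
        (B * ((k₂ ^ 2 - a ^ 2) * (k₂ ^ 2 - b ^ 2)))
        (C * ((k₃ ^ 2 - a ^ 2) * (k₃ ^ 2 - b ^ 2))) := by
  simp only [emdenFowlerOp, shiftDeriv_threeExp]
  congr 1 <;> ring

/-- A combination of a constant, an exponential and a linear function. -/
noncomputable def affineExp (k A B C t : ℝ) : ℝ := A + B * t + C * Real.exp (k * t)

theorem contDiff_affineExp (k A B C : ℝ) : ContDiff ℝ ∞ (affineExp k A B C) := by
  unfold affineExp
  fun_prop

theorem deriv_affineExp (k A B C : ℝ) :
    deriv (affineExp k A B C) = affineExp k B 0 (C * k) := by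
  funext t
  have h := (((hasDerivAt_id t).const_mul B).const_add A).add
    ((hasDerivAt_exp_mul k t).const_mul C)
  refine (HasDerivAt.deriv (f := affineExp k A B C) h).trans ?_
  simp only [affineExp]
  ring

theorem shiftDeriv_affineExp (l k A B C : ℝ) :
    shiftDeriv l (affineExp k A B C) = affineExp k (B - l * A) (-l * B) (C * (k - l)) := by
  funext t
  simp only [shiftDeriv, deriv_affineExp, affineExp]
  ring

theorem emdenFowlerOp_affineExp (a b k A B C : ℝ) :
    emdenFowlerOp a b (affineExp k A B C) =
      affineExp k (a ^ 2 * b ^ 2 * A) (a ^ 2 * b ^ 2 * B)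
        (C * ((k ^ 2 - a ^ 2) * (k ^ 2 - b ^ 2))) := by
  simp only [emdenFowlerOp, shiftDeriv_affineExp]
  congr 1 <;> ring

namespace IsIndicialPair

variable {a b μ s₁ s₂ : ℝ}

theorem s₁_lt_s₂ (h : IsIndicialPair a b μ s₁ s₂) : s₁ < s₂ := by
  have := h.s₁_lt; have := h.lt_s₂; have := h.b_eq; linarith

theorem symbol_eq (h : IsIndicialPair a b μ s₁ s₂) (k : ℝ) :
    (k ^ 2 - a ^ 2) * (k ^ 2 - b ^ 2) = μ + (k ^ 2 - s₁ ^ 2) * (k ^ 2 - s₂ ^ 2) := by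
  linear_combination k ^ 2 * h.sum_sq - h.prod_sq

end IsIndicialPair

/-! ### Positive kernels with Navier conditions -/

/-- A positive solution of `(D² - a²)(D² - b²) g = μ g` on `(0, ∞)` that satisfies the Navier
conditions at `0` and grows at most like `exp (θ t)`. -/
structure IsNavierKernel (a b μ θ : ℝ) (g : ℝ → ℝ) : Prop where
  contDiff : ContDiff ℝ ∞ g
  ode : ∀ t, emdenFowlerOp a b g t = μ * g t
  zero : g 0 = 0
  shiftDeriv_zero : shiftDeriv (-b) (shiftDeriv a g) 0 = 0
  pos : ∀ t, 0 < t → 0 < g t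
  iteratedDeriv_le : ∀ j : ℕ, ∃ C, ∀ t, 1 ≤ t → |iteratedDeriv j g t| ≤ C * g t
  growth : ∃ C, ∀ t, 1 ≤ t → g t ≤ C * Real.exp (θ * t)

/-- The kernel is (exp(s₁t) - exp(-s₁t)) + κ (exp(-s₁t) - exp(-s₂t)): both brackets vanish at 0 and
are positive afterwards. -/
theorem IsIndicialPair.exists_isNavierKernel_of_pos {a b μ s₁ s₂ : ℝ}
    (h : IsIndicialPair a b μ s₁ s₂) (hs : 0 < s₁) :
    ∃ g, IsNavierKernel a b μ s₁ g := by
  obtain ⟨ha, hb, _, h1, h2, h3, h4⟩ := id h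
  have h12 := h.s₁_lt_s₂
  -- Given g(0) = 0, the second Navier condition is g'' + 2g' = 0 at 0, which fixes κ; its
  -- denominator is positive because s₂ > b > 2.
  set κ := 4 * s₁ / ((s₂ - s₁) * (s₁ + s₂ - 2)) with hκ
  have hden : 0 < (s₂ - s₁) * (s₁ + s₂ - 2) := mul_pos (by linarith) (by linarith)
  have hκ0 : 0 < κ := by positivity
  have hκe : κ * ((s₂ - s₁) * (s₁ + s₂ - 2)) = 4 * s₁ := div_mul_cancel₀ _ hden.ne'
  have hlow : ∀ t, 1 ≤ t →
      (1 - Real.exp (-(2 * s₁))) * Real.exp (s₁ * t) ≤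
        threeExp s₁ (-s₁) (-s₂) 1 (κ - 1) (-κ) t := by
    intro t ht
    have e1 : Real.exp (-s₂ * t) ≤ Real.exp (-s₁ * t) := Real.exp_le_exp.2 (by nlinarith)
    have e2 : Real.exp (-s₁ * t) ≤ Real.exp (-(2 * s₁)) * Real.exp (s₁ * t) := by
      rw [← Real.exp_add]
      exact Real.exp_le_exp.2 (by nlinarith)
    simp only [threeExp]
    nlinarith
  have hc : 0 < 1 - Real.exp (-(2 * s₁)) := by
    have : Real.exp (-(2 * s₁)) < 1 := Real.exp_lt_one_iff.2 (by linarith)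
    linarith
  have hup : ∀ A B C t : ℝ, 1 ≤ t → |threeExp s₁ (-s₁) (-s₂) A B C t| ≤
      (|A| + |B| + |C|) * Real.exp (s₁ * t) := by
    intro A B C t ht
    have e1 : Real.exp (-s₁ * t) ≤ Real.exp (s₁ * t) := Real.exp_le_exp.2 (by nlinarith)
    have e2 : Real.exp (-s₂ * t) ≤ Real.exp (s₁ * t) := Real.exp_le_exp.2 (by nlinarith)
    calc |threeExp s₁ (-s₁) (-s₂) A B C t|
        ≤ |A| * Real.exp (s₁ * t) + |B| * Real.exp (-s₁ * t) + |C| * Real.exp (-s₂ * t) := by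
          refine (abs_add_three _ _ _).trans ?_
          simp [abs_mul]
      _ ≤ |A| * Real.exp (s₁ * t) + |B| * Real.exp (s₁ * t) + |C| * Real.exp (s₁ * t) := by
          gcongr
      _ = _ := by ring
  have hiter : ∀ j : ℕ, ∃ A B C, iteratedDeriv j (threeExp s₁ (-s₁) (-s₂) 1 (κ - 1) (-κ)) =
      threeExp s₁ (-s₁) (-s₂) A B C := by
    intro j
    induction j with
    | zero => exact ⟨_, _, _, iteratedDeriv_zero⟩
    | succ j ih =>
      obtain ⟨A, B, C, e⟩ := ih
      exact ⟨_, _, _, by rw [iteratedDeriv_succ, e, deriv_threeExp]⟩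
  refine ⟨threeExp s₁ (-s₁) (-s₂) 1 (κ - 1) (-κ), contDiff_threeExp _ _ _ _ _ _, ?_, ?_, ?_, ?_,
    ?_, ?_⟩
  · intro t
    rw [emdenFowlerOp_threeExp, h.symbol_eq, h.symbol_eq, h.symbol_eq]
    simp only [threeExp]
    ring
  · simp [threeExp]
  · simp only [shiftDeriv_threeExp, threeExp, mul_zero, Real.exp_zero, hb]
    linear_combination -hκe
  · intro t ht
    have e1 : Real.exp (-s₂ * t) < Real.exp (-s₁ * t) := Real.exp_lt_exp.2 (by nlinarith)
    have e2 : Real.exp (-s₁ * t) < Real.exp (s₁ * t) := Real.exp_lt_exp.2 (by nlinarith)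
    simp only [threeExp]
    nlinarith
  · intro j
    obtain ⟨A, B, C, e⟩ := hiter j
    refine ⟨(|A| + |B| + |C|) / (1 - Real.exp (-(2 * s₁))), fun t ht => ?_⟩
    rw [e]
    refine (hup A B C t ht).trans ?_
    rw [div_mul_eq_mul_div, le_div_iff₀ hc, mul_assoc]
    have := hlow t ht
    gcongr
    linarith
  · exact ⟨_, fun t ht => (le_abs_self _).trans (hup _ _ _ t ht)⟩

/-- The double root 0 contributes 1 and t, so the kernel is t + κ (1 - exp(-s₂t)); linear growth
lies below exp(θt) for every θ > 0. -/
theorem IsIndicialPair.exists_isNavierKernel_of_zero {a b μ s₂ θ : ℝ}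
    (h : IsIndicialPair a b μ 0 s₂) (hθ : 0 < θ) :
    ∃ g, IsNavierKernel a b μ θ g := by
  obtain ⟨ha, hb, _, h1, h2, h3, h4⟩ := id h
  set κ := 2 / (s₂ * (s₂ - 2)) with hκ
  have hden : 0 < s₂ * (s₂ - 2) := mul_pos (by linarith) (by linarith)
  have hκ0 : 0 < κ := by positivity
  have hκe : κ * (s₂ * (s₂ - 2)) = 2 := div_mul_cancel₀ _ hden.ne'
  have hlow : ∀ t, 0 < t → t ≤ affineExp (-s₂) κ 1 (-κ) t := by
    intro t ht
    have e1 : Real.exp (-s₂ * t) ≤ 1 := Real.exp_le_one_iff.2 (by nlinarith)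
    simp only [affineExp]
    nlinarith
  have hup : ∀ A B C t : ℝ, 1 ≤ t → |affineExp (-s₂) A B C t| ≤ (|A| + |B| + |C|) * t := by
    intro A B C t ht
    have e1 : Real.exp (-s₂ * t) ≤ 1 := Real.exp_le_one_iff.2 (by nlinarith)
    calc |affineExp (-s₂) A B C t|
        ≤ |A| + |B| * t + |C| * Real.exp (-s₂ * t) := by
          refine (abs_add_three _ _ _).trans ?_
          simp [abs_mul, abs_of_nonneg (zero_le_one.trans ht)]
      _ ≤ |A| * t + |B| * t + |C| * t := by
          have : |A| ≤ |A| * t := le_mul_of_one_le_right (abs_nonneg _) ht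
          gcongr
          linarith
      _ = _ := by ring
  have hiter : ∀ j : ℕ, ∃ A B C, iteratedDeriv j (affineExp (-s₂) κ 1 (-κ)) =
      affineExp (-s₂) A B C := by
    intro j
    induction j with
    | zero => exact ⟨_, _, _, iteratedDeriv_zero⟩
    | succ j ih =>
      obtain ⟨A, B, C, e⟩ := ih
      exact ⟨_, _, _, by rw [iteratedDeriv_succ, e, deriv_affineExp]⟩
  refine ⟨affineExp (-s₂) κ 1 (-κ), contDiff_affineExp _ _ _ _, ?_, ?_, ?_, ?_, ?_, ?_⟩
  · intro t
    have e : a ^ 2 * b ^ 2 = μ := by linarith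
    rw [emdenFowlerOp_affineExp, h.symbol_eq, e]
    simp only [affineExp]
    ring
  · simp [affineExp]
  · simp only [shiftDeriv_affineExp, affineExp, mul_zero, Real.exp_zero, hb]
    linear_combination -hκe
  · exact fun t ht => ht.trans_le (hlow t ht)
  · intro j
    obtain ⟨A, B, C, e⟩ := hiter j
    refine ⟨|A| + |B| + |C|, fun t ht => ?_⟩
    rw [e]
    refine (hup A B C t ht).trans ?_
    have := hlow t (by linarith)
    gcongr
  · refine ⟨(|κ| + |1| + |(-κ)|) / θ, fun t ht => ?_⟩
    refine ((le_abs_self _).trans (hup _ _ _ t ht)).trans ?_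
    rw [div_mul_eq_mul_div, mul_div_assoc]
    gcongr
    rw [le_div_iff₀ hθ]
    have := Real.add_one_le_exp (θ * t)
    linarith

/-! ### Truncation with bounds uniform in the cutoff position -/

theorem contDiff_iteratedDeriv_infty {g : ℝ → ℝ} (hg : ContDiff ℝ ∞ g) (j : ℕ) :
    ContDiff ℝ ∞ (iteratedDeriv j g) := by
  induction j with
  | zero => simpa using hg
  | succ j ih =>
    rw [iteratedDeriv_succ]
    exact (contDiff_infty_iff_deriv.1 ih).2

/-- Sums of terms `g⁽ʲ⁾(t) ψ(t - τ)ⁿ q(t - τ)` with smooth `q`, as functions of `τ` and `t`. -/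
inductive CutoffExpr (g ψ : ℝ → ℝ) (n : ℕ) : (ℝ → ℝ → ℝ) → Prop
  | term (j : ℕ) (q : ℝ → ℝ) (hq : ContDiff ℝ ∞ q) :
      CutoffExpr g ψ n fun τ t => iteratedDeriv j g t * (ψ (t - τ) ^ n * q (t - τ))
  | add (F G : ℝ → ℝ → ℝ) (hF : CutoffExpr g ψ n F) (hG : CutoffExpr g ψ n G) :
      CutoffExpr g ψ n fun τ t => F τ t + G τ t

namespace CutoffExpr

variable {g ψ : ℝ → ℝ} {n : ℕ} {F : ℝ → ℝ → ℝ}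

theorem contDiff (hg : ContDiff ℝ ∞ g) (hψ : ContDiff ℝ ∞ ψ) (hF : CutoffExpr g ψ n F) (τ : ℝ) :
    ContDiff ℝ ∞ (F τ) := by
  induction hF with
  | term j q hq =>
    have hs : ContDiff ℝ ∞ fun t : ℝ => t - τ := contDiff_id.sub contDiff_const
    exact (contDiff_iteratedDeriv_infty hg j).mul (((hψ.comp hs).pow n).mul (hq.comp hs))
  | add F G _ _ ihF ihG => exact ihF.add ihG

theorem const_mul (hF : CutoffExpr g ψ n F) (c : ℝ) :
    CutoffExpr g ψ n fun τ t => c * F τ t := by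
  induction hF with
  | term j q hq =>
    convert term (g := g) (ψ := ψ) (n := n) j (fun s => c * q s) (contDiff_const.mul hq) using 3
    ring
  | add F G _ _ ihF ihG =>
    convert add _ _ ihF ihG using 3
    ring

theorem of_succ (hψ : ContDiff ℝ ∞ ψ) (hF : CutoffExpr g ψ (n + 1) F) : CutoffExpr g ψ n F := by
  induction hF with
  | term j q hq =>
    convert term (g := g) (ψ := ψ) (n := n) j (fun s => ψ s * q s) (hψ.mul hq) using 3
    ring
  | add F G _ _ ihF ihG => exact add _ _ ihF ihG

/-- A derivative lowers the power of ψ by at most one, so a fourth-order operator loses at most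
four. The coefficients q depend only on t - τ, which keeps later bounds independent of τ. -/
theorem deriv (hg : ContDiff ℝ ∞ g) (hψ : ContDiff ℝ ∞ ψ) (hF : CutoffExpr g ψ (n + 1) F) :
    CutoffExpr g ψ n fun τ => deriv (F τ) := by
  induction hF with
  | term j q hq =>
    have hψ' := (contDiff_infty_iff_deriv.1 hψ).2
    have hq' := (contDiff_infty_iff_deriv.1 hq).2
    convert add _ _
      (term (g := g) (ψ := ψ) (n := n) (j + 1) (fun s => ψ s * q s) (hψ.mul hq))
      (term (g := g) (ψ := ψ) (n := n) j
        (fun s => (n + 1) * _root_.deriv ψ s * q s + ψ s * _root_.deriv q s)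
        (((contDiff_const.mul hψ').mul hq).add (hψ.mul hq'))) using 1
    funext τ t
    have hs : HasDerivAt (fun t : ℝ => t - τ) 1 t := (hasDerivAt_id t).sub_const τ
    have h1 : HasDerivAt (iteratedDeriv j g) (iteratedDeriv (j + 1) g t) t := by
      rw [iteratedDeriv_succ]
      exact ((contDiff_iteratedDeriv_infty hg j).differentiable (by simp) t).hasDerivAt
    have h2 := ((hψ.differentiable (by simp) (t - τ)).hasDerivAt.comp t hs).pow (n + 1)
    have h3 := (hq.differentiable (by simp) (t - τ)).hasDerivAt.comp t hs
    refine (HasDerivAt.deriv (f := fun t => iteratedDeriv j g t *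
      (ψ (t - τ) ^ (n + 1) * q (t - τ))) (h1.mul (h2.mul h3))).trans ?_
    simp
    ring
  | add F G hF hG ihF ihG =>
    convert add _ _ ihF ihG using 1
    funext τ t
    exact deriv_add ((hF.contDiff hg hψ τ).differentiable (by simp) t)
      ((hG.contDiff hg hψ τ).differentiable (by simp) t)

theorem shiftDeriv (hg : ContDiff ℝ ∞ g) (hψ : ContDiff ℝ ∞ ψ) (hF : CutoffExpr g ψ (n + 1) F)
    (l : ℝ) : CutoffExpr g ψ n fun τ => shiftDeriv l (F τ) := by
  convert add _ _ (hF.deriv hg hψ) ((hF.of_succ hψ).const_mul (-l)) using 3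
  simp only [_root_.shiftDeriv]
  ring

/-- Each q is bounded on [0, 1], and the derivatives of g are dominated by g itself, so one constant
serves all shells. -/
theorem exists_abs_le (hg : ∀ j : ℕ, ∃ C, ∀ t, 1 ≤ t → |iteratedDeriv j g t| ≤ C * g t)
    (hg0 : ∀ t, 1 ≤ t → 0 ≤ g t) (hψ0 : ∀ s, 0 ≤ ψ s) (hF : CutoffExpr g ψ n F) :
    ∃ C, 0 ≤ C ∧ ∀ τ, 1 ≤ τ → ∀ t ∈ Icc τ (τ + 1), |F τ t| ≤ C * (g t * ψ (t - τ) ^ n) := by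
  induction hF with
  | term j q hq =>
    obtain ⟨C, hC⟩ := hg j
    obtain ⟨B, hB⟩ := (isCompact_Icc (a := (0 : ℝ)) (b := 1)).exists_bound_of_continuousOn
      hq.continuous.continuousOn
    refine ⟨|C| * |B|, by positivity, fun τ hτ t ht => ?_⟩
    have ht1 : 1 ≤ t := hτ.trans ht.1
    have e1 : |iteratedDeriv j g t| ≤ |C| * g t :=
      (hC t ht1).trans (mul_le_mul_of_nonneg_right (le_abs_self C) (hg0 t ht1))
    have e2 : |q (t - τ)| ≤ |B| :=
      (hB (t - τ) ⟨by linarith [ht.1], by linarith [ht.2]⟩).trans (le_abs_self B)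
    have e3 : 0 ≤ ψ (t - τ) ^ n := pow_nonneg (hψ0 _) n
    have e4 : 0 ≤ g t := hg0 t ht1
    calc |iteratedDeriv j g t * (ψ (t - τ) ^ n * q (t - τ))|
        = |iteratedDeriv j g t| * (ψ (t - τ) ^ n * |q (t - τ)|) := by
          rw [abs_mul, abs_mul, abs_of_nonneg e3]
      _ ≤ (|C| * g t) * (ψ (t - τ) ^ n * |B|) := by gcongr
      _ = _ := by ring
  | add F G _ _ ihF ihG =>
    obtain ⟨C, hC0, hC⟩ := ihF
    obtain ⟨C', hC0', hC'⟩ := ihG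
    refine ⟨C + C', by positivity, fun τ hτ t ht => ?_⟩
    have := abs_add_le (F τ t) (G τ t)
    have := hC τ hτ t ht
    have := hC' τ hτ t ht
    linarith

end CutoffExpr

/-- A smooth nonincreasing cutoff equal to `1` on `(-∞, 0]` and to `0` on `[1, ∞)`. -/
noncomputable def smoothCutoff (s : ℝ) : ℝ := Real.smoothTransition (1 - s)

theorem contDiff_smoothCutoff : ContDiff ℝ ∞ smoothCutoff :=
  Real.smoothTransition.contDiff.comp (contDiff_const.sub contDiff_id)

theorem smoothCutoff_nonneg (s : ℝ) : 0 ≤ smoothCutoff s := Real.smoothTransition.nonneg _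

theorem smoothCutoff_le_one (s : ℝ) : smoothCutoff s ≤ 1 := Real.smoothTransition.le_one _

theorem smoothCutoff_of_nonpos {s : ℝ} (hs : s ≤ 0) : smoothCutoff s = 1 :=
  Real.smoothTransition.one_of_one_le (by linarith)

theorem smoothCutoff_of_one_le {s : ℝ} (hs : 1 ≤ s) : smoothCutoff s = 0 :=
  Real.smoothTransition.zero_of_nonpos (by linarith)

/-- The truncation of `g` beyond `τ`. -/
noncomputable def truncated (g : ℝ → ℝ) (m : ℕ) (τ t : ℝ) : ℝ := g t * smoothCutoff (t - τ) ^ m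

section Truncated

variable {g : ℝ → ℝ} {m : ℕ} {τ t : ℝ}

theorem cutoffExpr_truncated (g : ℝ → ℝ) (m : ℕ) :
    CutoffExpr g smoothCutoff m (truncated g m) := by
  convert CutoffExpr.term (g := g) (ψ := smoothCutoff) (n := m) 0 (fun _ => 1)
    contDiff_const using 3
  simp [truncated]

theorem contDiff_truncated (hg : ContDiff ℝ ∞ g) (m : ℕ) (τ : ℝ) :
    ContDiff ℝ ∞ (truncated g m τ) :=
  (cutoffExpr_truncated g m).contDiff hg contDiff_smoothCutoff τ

theorem truncated_of_le (ht : t ≤ τ) : truncated g m τ t = g t := by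
  simp [truncated, smoothCutoff_of_nonpos (sub_nonpos.2 ht)]

theorem truncated_of_ge (hm : m ≠ 0) (ht : τ + 1 ≤ t) : truncated g m τ t = 0 := by
  simp [truncated, smoothCutoff_of_one_le (s := t - τ) (by linarith), hm]

theorem truncated_eventuallyEq_of_lt (ht : t < τ) : truncated g m τ =ᶠ[nhds t] g := by
  filter_upwards [Iio_mem_nhds ht] with s hs
  exact truncated_of_le (le_of_lt hs)

theorem truncated_eventuallyEq_of_gt (hm : m ≠ 0) (ht : τ + 1 < t) :
    truncated g m τ =ᶠ[nhds t] fun _ => 0 := by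
  filter_upwards [Ioi_mem_nhds ht] with s hs
  exact truncated_of_ge hm (le_of_lt hs)

theorem Filter.EventuallyEq.shiftDeriv {v w : ℝ → ℝ} {t : ℝ} (h : v =ᶠ[nhds t] w) (l : ℝ) :
    shiftDeriv l v =ᶠ[nhds t] shiftDeriv l w := by
  filter_upwards [h, h.deriv] with s h1 h2
  simp only [_root_.shiftDeriv, h1, h2]

theorem emdenFowlerOp_congr {v w : ℝ → ℝ} {t : ℝ} (h : v =ᶠ[nhds t] w) (a b : ℝ) :
    emdenFowlerOp a b v t = emdenFowlerOp a b w t :=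
  ((((h.shiftDeriv a).shiftDeriv (-b)).shiftDeriv b).shiftDeriv (-a)).eq_of_nhds

theorem emdenFowlerOp_zero (a b t : ℝ) : emdenFowlerOp a b (fun _ => 0) t = 0 := by
  have h : ∀ l : ℝ, shiftDeriv l (fun _ => 0) = fun _ => 0 := by
    intro l
    funext s
    simp [shiftDeriv]
  simp only [emdenFowlerOp, h]

namespace IsNavierKernel

variable {a b μ θ : ℝ}

theorem nonneg (h : IsNavierKernel a b μ θ g) (ht : 0 ≤ t) : 0 ≤ g t := by
  rcases ht.eq_or_lt with rfl | h0
  · exact h.zero.ge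
  · exact (h.pos t h0).le

theorem emdenFowlerOp_truncated_sub_of_notMem (h : IsNavierKernel a b μ θ g) (hm : m ≠ 0)
    (ht : t ∉ Icc τ (τ + 1)) :
    emdenFowlerOp a b (truncated g m τ) t - μ * truncated g m τ t = 0 := by
  rcases lt_or_ge t τ with hlt | hge
  · rw [emdenFowlerOp_congr (truncated_eventuallyEq_of_lt hlt), h.ode, truncated_of_le hlt.le,
      sub_self]
  · have hgt : τ + 1 < t := by
      by_contra hc
      exact ht ⟨hge, not_lt.1 hc⟩
    rw [emdenFowlerOp_congr (truncated_eventuallyEq_of_gt hm hgt), emdenFowlerOp_zero,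
      truncated_of_ge hm hgt.le]
    ring

theorem exists_abs_emdenFowlerOp_truncated_sub_le (h : IsNavierKernel a b μ θ g) (n : ℕ) :
    ∃ C, 0 ≤ C ∧ ∀ τ, 1 ≤ τ → ∀ t ∈ Icc τ (τ + 1),
      |emdenFowlerOp a b (truncated g (n + 4) τ) t - μ * truncated g (n + 4) τ t| ≤
        C * (g t * smoothCutoff (t - τ) ^ n) := by
  have hψ := contDiff_smoothCutoff
  have h0 := cutoffExpr_truncated g (n + 4)
  have h4 := (((h0.shiftDeriv h.contDiff hψ a).shiftDeriv h.contDiff hψ (-b)).shiftDeriv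
    h.contDiff hψ b).shiftDeriv h.contDiff hψ (-a)
  have h5 := CutoffExpr.add _ _ h4
    (((((h0.of_succ hψ).of_succ hψ).of_succ hψ).of_succ hψ).const_mul (-μ))
  obtain ⟨C, hC0, hC⟩ := h5.exists_abs_le h.iteratedDeriv_le
    (fun t ht => h.nonneg (by linarith)) smoothCutoff_nonneg
  refine ⟨C, hC0, fun τ hτ t ht => ?_⟩
  have := hC τ hτ t ht
  rw [neg_mul, ← sub_eq_add_neg] at this
  exact this

end IsNavierKernel

end Truncated

/-! ### Truncated kernels as test functions -/

theorem isCompact_closedExteriorDomain_inter_closedBall (N : ℕ) (R : ℝ) :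
    IsCompact (closedExteriorDomain N ∩ Metric.closedBall 0 R) :=
  (isCompact_closedBall _ _).inter_left (isClosed_closedExteriorDomain N)

theorem rpow_eq_exp_mul_log {r : ℝ} (hr : 0 < r) (s : ℝ) : r ^ s = Real.exp (s * Real.log r) := by
  rw [Real.rpow_def_of_pos hr, mul_comm]

section TestFunction

variable {N : ℕ} {μ θ : ℝ} {g : ℝ → ℝ} {m : ℕ} {τ : ℝ}

theorem radialProfile_truncated_nonneg {a b : ℝ} (hg : IsNavierKernel a b μ θ g)
    {x : EuclideanSpace ℝ (Fin N)} (hx : x ∈ closedExteriorDomain N) :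
    0 ≤ radialProfile a (truncated g m τ) x :=
  mul_nonneg (Real.rpow_nonneg (norm_nonneg _) _)
    (mul_nonneg (hg.nonneg (Real.log_nonneg (mem_closedExteriorDomain.1 hx)))
      (pow_nonneg (smoothCutoff_nonneg _) _))

theorem radialProfile_truncated_eq_zero {a : ℝ} (hm : m ≠ 0)
    {x : EuclideanSpace ℝ (Fin N)} (hx : Real.exp (τ + 1) ≤ ‖x‖) :
    radialProfile a (truncated g m τ) x = 0 := by
  have h : τ + 1 ≤ Real.log ‖x‖ := (Real.le_log_iff_exp_le ((Real.exp_pos _).trans_le hx)).2 hx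
  simp [radialProfile, truncated_of_ge hm h]

theorem radialProfile_truncated_eq {a : ℝ} {x : EuclideanSpace ℝ (Fin N)} (h0 : x ≠ 0)
    (hx : ‖x‖ ≤ Real.exp τ) :
    radialProfile a (truncated g m τ) x = radialProfile a g x := by
  have h : Real.log ‖x‖ ≤ τ := (Real.log_le_iff_le_exp (norm_pos_iff.2 h0)).2 hx
  simp [radialProfile, truncated_of_le h]

theorem radialProfile_truncated_le {a b : ℝ} (hg : IsNavierKernel a b μ θ g)
    {x : EuclideanSpace ℝ (Fin N)} (hx : x ∈ closedExteriorDomain N) :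
    radialProfile a (truncated g m τ) x ≤ radialProfile a g x :=
  mul_le_mul_of_nonneg_left
    (mul_le_of_le_one_right (hg.nonneg (Real.log_nonneg (mem_closedExteriorDomain.1 hx)))
      (pow_le_one₀ (smoothCutoff_nonneg _) (smoothCutoff_le_one _)))
    (Real.rpow_nonneg (norm_nonneg _) _)

theorem isTestFunction_radialProfile_truncated
    (hg : IsNavierKernel (((N : ℝ) - 4) / 2) (N / 2) μ θ g) (hm : m ≠ 0) (hτ : 0 < τ) :
    IsTestFunction (radialProfile (((N : ℝ) - 4) / 2) (truncated g m τ) :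
      EuclideanSpace ℝ (Fin N) → ℝ) where
  contDiffOn := (contDiffOn_radialProfile _ (contDiff_truncated hg.contDiff m τ)).of_le
    ENat.LEInfty.out
  compactSupport := by
    refine ⟨_, isCompact_closedExteriorDomain_inter_closedBall N (Real.exp (τ + 1)),
      inter_subset_left, fun x hx hxK => radialProfile_truncated_eq_zero hm ?_⟩
    by_contra hlt
    exact hxK ⟨hx, mem_closedBall_zero_iff.2 (not_le.1 hlt).le⟩
  nonneg := fun x hx => radialProfile_truncated_nonneg hg hx
  navier := by
    -- As τ > 0, the cutoff is inactive near t = 0 and the boundary conditions are those of g.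
    have he := truncated_eventuallyEq_of_lt (g := g) (m := m) hτ
    refine navierBoundary_radialProfile_eq (contDiff_truncated hg.contDiff m τ) ?_ ?_
    · rw [he.eq_of_nhds, hg.zero]
    · rw [((he.shiftDeriv _).shiftDeriv _).eq_of_nhds, hg.shiftDeriv_zero]

end TestFunction

/-! ### The Hölder estimate on a shell -/

theorem le_rpow_of_le_mul_rpow {I M p : ℝ} (hp : 1 < p) (hI : 0 ≤ I) (hM : 0 ≤ M)
    (h : I ≤ M * I ^ (1 / p)) : I ≤ M ^ (p / (p - 1)) := by
  rcases hI.eq_or_lt with rfl | hpos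
  · exact Real.rpow_nonneg hM _
  have hp0 : 0 < p := by linarith
  have hp1 : 0 < p - 1 := by linarith
  have e : I = I ^ ((p - 1) / p) * I ^ (1 / p) := by
    rw [← Real.rpow_add hpos, ← add_div, sub_add_cancel, div_self hp0.ne', Real.rpow_one]
  have h1 : I ^ ((p - 1) / p) ≤ M :=
    le_of_mul_le_mul_right (e.symm.trans_le h) (Real.rpow_pos_of_pos hpos _)
  calc I = (I ^ ((p - 1) / p)) ^ (p / (p - 1)) := by
        rw [← Real.rpow_mul hI, div_mul_div_cancel₀ hp0.ne', div_self hp1.ne', Real.rpow_one]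
    _ ≤ M ^ (p / (p - 1)) := Real.rpow_le_rpow (Real.rpow_nonneg hI _) h1 (by positivity)

/-- The pointwise estimate behind Hölder's inequality on the shell `τ ≤ t ≤ τ + 1`. -/
theorem mul_le_rpow_mul_exp {a σ p θ G U t τ γ ψ n' : ℝ} {n : ℕ} (hp : 1 < p)
    (hθ : (a + θ) * (p - 1) ≤ σ + 4) (hn : (n : ℝ) + 4 ≤ n * p) (hn' : n' = 2 * a + 4)
    (ha : 0 < a) (hU : 0 ≤ U) (hG : 0 ≤ G) (hγ0 : 0 ≤ γ) (hγ : γ ≤ G * Real.exp (θ * t))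
    (hψ0 : 0 ≤ ψ) (hψ1 : ψ ≤ 1) (hτ : τ ≤ t) (hτ0 : 0 ≤ τ) :
    U * (Real.exp (-(a + 4) * t) * (γ * ψ ^ n)) ≤
      (Real.exp (σ * t) * U ^ p * (Real.exp (-a * t) * (γ * ψ ^ (n + 4)))) ^ (1 / p) *
        (G ^ ((p - 1) / p) * Real.exp (-n' * τ * ((p - 1) / p))) := by
  have hp0 : 0 < p := by linarith
  have hp1 : 0 < p - 1 := by linarith
  have hpp : 1 / p + (p - 1) / p = 1 := by field_simp; ring
  have e1 : (Real.exp (σ * t) * U ^ p * (Real.exp (-a * t) * (γ * ψ ^ (n + 4)))) ^ (1 / p) =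
      Real.exp ((σ - a) * t / p) * U * (γ ^ (1 / p) * (ψ ^ (n + 4)) ^ (1 / p)) := by
    have hU' : (U ^ p) ^ (1 / p) = U := by
      rw [← Real.rpow_mul hU, mul_one_div_cancel hp0.ne', Real.rpow_one]
    rw [Real.mul_rpow (by positivity) (by positivity), Real.mul_rpow (by positivity) (by positivity),
      Real.mul_rpow (by positivity) (by positivity), Real.mul_rpow hγ0 (by positivity), hU',
      ← Real.exp_mul, ← Real.exp_mul]
    rw [show (σ - a) * t / p = σ * t * (1 / p) + -a * t * (1 / p) by ring, Real.exp_add]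
    ring
  -- As 0 ≤ ψ ≤ 1, it suffices that (n + 4)/p ≤ n: the four lost powers are absorbed by taking n
  -- large.
  have e2 : ψ ^ n ≤ (ψ ^ (n + 4)) ^ (1 / p) := by
    rw [← Real.rpow_natCast ψ (n + 4), ← Real.rpow_mul hψ0, ← Real.rpow_natCast ψ n]
    refine Real.rpow_le_rpow_of_exponent_ge' hψ0 hψ1 (by positivity) ?_
    rw [mul_one_div, div_le_iff₀ hp0]
    push_cast
    exact hn
  have e3 : γ = γ ^ (1 / p) * γ ^ ((p - 1) / p) := by
    rw [← Real.rpow_add_of_nonneg hγ0 (by positivity) (by positivity), hpp, Real.rpow_one]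
  have e4 : γ ^ ((p - 1) / p) ≤ G ^ ((p - 1) / p) * Real.exp (θ * t * ((p - 1) / p)) := by
    rw [Real.exp_mul, ← Real.mul_rpow hG (Real.exp_pos _).le]
    exact Real.rpow_le_rpow hγ0 hγ (by positivity)
  -- After multiplication by p, the exponents differ by at least (2a + 4)(p - 1)t - n'τ(p - 1) ≥ 0;
  -- this is where (a + θ)(p - 1) ≤ σ + 4 enters.
  have e5 : Real.exp (-(a + 4) * t) * Real.exp (θ * t * ((p - 1) / p)) ≤
      Real.exp ((σ - a) * t / p) * Real.exp (-n' * τ * ((p - 1) / p)) := by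
    rw [← Real.exp_add, ← Real.exp_add, Real.exp_le_exp]
    have h1 : n' * τ * (p - 1) ≤ n' * t * (p - 1) := by
      have : 0 ≤ n' := by linarith
      gcongr
    have h2 : ((a + θ) * (p - 1)) * t ≤ (σ + 4) * t :=
      mul_le_mul_of_nonneg_right hθ (hτ0.trans hτ)
    rw [← sub_nonneg]
    have : 0 ≤ ((σ - a) * t + -n' * τ * (p - 1) + (a + 4) * t * p - θ * t * (p - 1)) / p := by
      apply div_nonneg _ hp0.le
      subst hn'
      linarith
    convert this using 1
    field_simp
    ring
  have hX : 0 ≤ γ ^ (1 / p) := Real.rpow_nonneg hγ0 _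
  have hY : 0 ≤ (ψ ^ (n + 4)) ^ (1 / p) := by positivity
  have hZ : 0 ≤ G ^ ((p - 1) / p) := Real.rpow_nonneg hG _
  rw [e1]
  calc U * (Real.exp (-(a + 4) * t) * (γ * ψ ^ n))
      = U * (Real.exp (-(a + 4) * t) * (γ ^ (1 / p) * γ ^ ((p - 1) / p) * ψ ^ n)) := by rw [← e3]
    _ ≤ U * (Real.exp (-(a + 4) * t) * (γ ^ (1 / p) *
          (G ^ ((p - 1) / p) * Real.exp (θ * t * ((p - 1) / p))) *
            (ψ ^ (n + 4)) ^ (1 / p))) := by gcongr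
    _ = U * γ ^ (1 / p) * (ψ ^ (n + 4)) ^ (1 / p) * G ^ ((p - 1) / p) *
          (Real.exp (-(a + 4) * t) * Real.exp (θ * t * ((p - 1) / p))) := by ring
    _ ≤ U * γ ^ (1 / p) * (ψ ^ (n + 4)) ^ (1 / p) * G ^ ((p - 1) / p) *
          (Real.exp ((σ - a) * t / p) * Real.exp (-n' * τ * ((p - 1) / p))) := by gcongr
    _ = _ := by ring

/-- The shell `exp τ ≤ ‖x‖ ≤ exp (τ + 1)`. -/
def expShell (N : ℕ) (τ : ℝ) : Set (EuclideanSpace ℝ (Fin N)) :=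
  {x | Real.exp τ ≤ ‖x‖ ∧ ‖x‖ ≤ Real.exp (τ + 1)}

theorem mem_expShell {N : ℕ} {τ : ℝ} {x : EuclideanSpace ℝ (Fin N)} :
    x ∈ expShell N τ ↔ Real.exp τ ≤ ‖x‖ ∧ ‖x‖ ≤ Real.exp (τ + 1) := Iff.rfl

theorem measurableSet_expShell (N : ℕ) (τ : ℝ) : MeasurableSet (expShell N τ) :=
  ((isClosed_le continuous_const continuous_norm).inter
    (isClosed_le continuous_norm continuous_const)).measurableSet

theorem expShell_subset_exteriorDomain (N : ℕ) {τ : ℝ} (hτ : 0 < τ) :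
    expShell N τ ⊆ exteriorDomain N := fun _ hx =>
  mem_exteriorDomain.2 ((Real.one_lt_exp_iff.2 hτ).trans_le (mem_expShell.1 hx).1)

theorem expShell_subset_closedBall (N : ℕ) (τ : ℝ) :
    expShell N τ ⊆ Metric.closedBall 0 (Real.exp (τ + 1)) := fun _ hx =>
  mem_closedBall_zero_iff.2 (mem_expShell.1 hx).2

theorem mem_expShell_iff_log {N : ℕ} {τ : ℝ} {x : EuclideanSpace ℝ (Fin N)} (hx : x ≠ 0) :
    x ∈ expShell N τ ↔ Real.log ‖x‖ ∈ Icc τ (τ + 1) := by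
  have h0 : 0 < ‖x‖ := norm_pos_iff.2 hx
  rw [mem_expShell, mem_Icc, Real.le_log_iff_exp_le h0, Real.log_le_iff_le_exp h0]

theorem volume_real_expShell_le (N : ℕ) (τ : ℝ) :
    volume.real (expShell N τ) ≤ Real.exp ((τ + 1) * N) *
      volume.real (Metric.ball (0 : EuclideanSpace ℝ (Fin N)) 1) := by
  refine (measureReal_mono (expShell_subset_closedBall N τ)
    (measure_closedBall_lt_top).ne).trans ?_
  rw [Measure.addHaar_real_closedBall _ _ (Real.exp_pos _).le, finrank_euclideanSpace,
    Fintype.card_fin, ← Real.exp_nat_mul, mul_comm (N : ℝ)]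

section WeakSolution

variable {N : ℕ} {μ σ p : ℝ} {f u : EuclideanSpace ℝ (Fin N) → ℝ}

theorem IsWeakSolution.integrableOn_source (hu : IsWeakSolution μ σ p f u) (hp : 1 < p)
    {K : Set (EuclideanSpace ℝ (Fin N))} (hK : IsCompact K) (hKs : K ⊆ closedExteriorDomain N) :
    IntegrableOn (fun x => ‖x‖ ^ σ * |u x| ^ p) K := by
  have hp0 : 0 < p := by linarith
  have h := (hu.memLp_loc K hK hKs).integrable_norm_rpow (by simpa using hp0) ENNReal.ofReal_ne_top
  rw [ENNReal.toReal_ofReal hp0.le] at h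
  refine IntegrableOn.continuousOn_mul ?_ h hK
  exact continuous_norm.continuousOn.rpow_const fun x hx =>
    Or.inl (norm_ne_zero_iff.2 (ne_zero_of_mem_closedExteriorDomain (hKs hx)))

theorem continuousOn_radialProfile {a : ℝ} {w : ℝ → ℝ} (hw : ContDiff ℝ ∞ w)
    {K : Set (EuclideanSpace ℝ (Fin N))} (hKs : K ⊆ closedExteriorDomain N) :
    ContinuousOn (radialProfile a w) K :=
  (contDiffOn_radialProfile a hw).continuousOn.mono hKs

theorem integrableOn_mul_radialProfile_truncated {h : EuclideanSpace ℝ (Fin N) → ℝ} {a τ : ℝ}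
    {m : ℕ} {g : ℝ → ℝ}
    (hh : ∀ K, IsCompact K → K ⊆ closedExteriorDomain N → IntegrableOn h K)
    (hg : ContDiff ℝ ∞ g) (hm : m ≠ 0) :
    IntegrableOn (fun x => h x * radialProfile a (truncated g m τ) x) (exteriorDomain N) := by
  have hK := isCompact_closedExteriorDomain_inter_closedBall N (Real.exp (τ + 1))
  have h1 := (hh _ hK inter_subset_left).mul_continuousOn
    (continuousOn_radialProfile (a := a) (contDiff_truncated hg m τ) inter_subset_left) hK
  refine h1.of_forall_sdiff_eq_zero (isOpen_exteriorDomain N).measurableSet fun x hx => ?_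
  rw [radialProfile_truncated_eq_zero hm, mul_zero]
  by_contra hlt
  exact hx.2 ⟨exteriorDomain_subset_closedExteriorDomain N hx.1,
    mem_closedBall_zero_iff.2 (not_le.1 hlt).le⟩

/-- M must not depend on τ: the volume of the shell grows at most like exp(Nτ), and the Hölder
weight B satisfies B^q = G exp(-Nτ), which compensates it exactly. -/
theorem exists_source_mul_profile_estimate {θ : ℝ} {g : ℝ → ℝ} (hN : 5 ≤ N)
    (hg : IsNavierKernel (((N : ℝ) - 4) / 2) (N / 2) μ θ g) (hp : 1 < p)
    (hθ : (((N : ℝ) - 4) / 2 + θ) * (p - 1) ≤ σ + 4) {n : ℕ} (hn : (n : ℝ) + 4 ≤ n * p) :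
    ∃ M, 0 ≤ M ∧ ∀ f u : EuclideanSpace ℝ (Fin N) → ℝ, IsWeakSolution μ σ p f u →
      ∀ τ, 1 ≤ τ →
      (∫ x in exteriorDomain N, ‖x‖ ^ σ * |u x| ^ p *
          radialProfile (((N : ℝ) - 4) / 2) (truncated g (n + 4) τ) x) +
        (∫ x in exteriorDomain N,
          f x * radialProfile (((N : ℝ) - 4) / 2) (truncated g (n + 4) τ) x) ≤
      M * (∫ x in expShell N τ, ‖x‖ ^ σ * |u x| ^ p *
          radialProfile (((N : ℝ) - 4) / 2) (truncated g (n + 4) τ) x) ^ (1 / p) := by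
  have hN' : (5 : ℝ) ≤ N := by exact_mod_cast hN
  set a : ℝ := ((N : ℝ) - 4) / 2 with ha
  have ha0 : 0 < a := by rw [ha]; linarith
  have hp0 : 0 < p := by linarith
  have hp1 : 0 < p - 1 := by linarith
  set q : ℝ := p / (p - 1) with hq
  have hpq : p.HolderConjugate q := Real.HolderConjugate.conjExponent hp
  have hq0 : 0 < q := hpq.symm.pos
  have hqinv : (p - 1) / p * q = 1 := by rw [hq]; field_simp
  obtain ⟨C, hC0, hC⟩ := hg.exists_abs_emdenFowlerOp_truncated_sub_le n
  obtain ⟨G', hG'⟩ := hg.growth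
  set G := |G'| with hG
  have hGg : ∀ t, 1 ≤ t → g t ≤ G * Real.exp (θ * t) := fun t ht =>
    (hG' t ht).trans (mul_le_mul_of_nonneg_right (le_abs_self _) (Real.exp_pos _).le)
  set V := volume.real (Metric.ball (0 : EuclideanSpace ℝ (Fin N)) 1) with hV
  have hV0 : 0 ≤ V := measureReal_nonneg
  refine ⟨C * (Real.exp N * V * G) ^ (1 / q), by positivity, fun f u hu τ hτ => ?_⟩
  have hτ0 : 0 < τ := by linarith
  set φ : EuclideanSpace ℝ (Fin N) → ℝ := radialProfile a (truncated g (n + 4) τ) with hφ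
  have hS := measurableSet_expShell N τ
  have hSΩ := expShell_subset_exteriorDomain N hτ0
  have hΩ := (isOpen_exteriorDomain N).measurableSet
  have hsub := exteriorDomain_subset_closedExteriorDomain N
  rw [hu.weak_eq φ (isTestFunction_radialProfile_truncated hg (by simp) hτ0)]
  set B : ℝ := G ^ ((p - 1) / p) * Real.exp (-N * τ * ((p - 1) / p)) with hB
  have hB0 : 0 ≤ B := by positivity
  have hL : ∀ x ∈ exteriorDomain N, u x * (Δ (Δ φ) x - μ / ‖x‖ ^ 4 * φ x) =
      u x * radialProfile (a + 4) (fun t => emdenFowlerOp a (N / 2) (truncated g (n + 4) τ) t -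
        μ * truncated g (n + 4) τ t) x := by
    intro x hx
    have hx0 := ne_zero_of_mem_closedExteriorDomain (hsub hx)
    rw [laplacian_laplacian_radialProfile_eq (contDiff_truncated hg.contDiff _ τ) hx0, ← ha]
    have := radialProfile_add_four a (truncated g (n + 4) τ) hx0
    rw [div_eq_mul_one_div μ, mul_assoc, hφ, ← this]
    simp only [radialProfile]
    ring
  set ρφ : EuclideanSpace ℝ (Fin N) → ℝ := fun x => ‖x‖ ^ σ * |u x| ^ p * φ x with hρφ
  have hρφ0 : ∀ x ∈ exteriorDomain N, 0 ≤ ρφ x := fun x hx =>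
    mul_nonneg (by positivity) (radialProfile_truncated_nonneg hg (hsub hx))
  have hρφi : IntegrableOn ρφ (exteriorDomain N) :=
    integrableOn_mul_radialProfile_truncated (fun K => hu.integrableOn_source hp) hg.contDiff
      (by simp)
  have hρφS : IntegrableOn ρφ (expShell N τ) := hρφi.mono_set hSΩ
  have hvol : volume (expShell N τ) ≠ ⊤ :=
    ((measure_mono (expShell_subset_closedBall N τ)).trans_lt measure_closedBall_lt_top).ne
  have : IsFiniteMeasure (volume.restrict (expShell N τ)) :=
    isFiniteMeasure_restrict.2 hvol
  set A : EuclideanSpace ℝ (Fin N) → ℝ := fun x => ρφ x ^ (1 / p) with hA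
  have hAp : ∀ x ∈ expShell N τ, A x ^ p = ρφ x := fun x hx => by
    rw [hA, ← Real.rpow_mul (hρφ0 x (hSΩ hx)), one_div_mul_cancel hp0.ne', Real.rpow_one]
  have hA0 : ∀ x ∈ expShell N τ, 0 ≤ A x := fun x hx => Real.rpow_nonneg (hρφ0 x (hSΩ hx)) _
  have hAm : MemLp A (ENNReal.ofReal p) (volume.restrict (expShell N τ)) := by
    have hmeas : AEStronglyMeasurable A (volume.restrict (expShell N τ)) :=
      (hρφS.aemeasurable.pow_const _).aestronglyMeasurable
    rw [← integrable_norm_rpow_iff hmeas (by simpa using hp0) ENNReal.ofReal_ne_top,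
      ENNReal.toReal_ofReal hp0.le]
    refine Integrable.congr hρφS ((ae_restrict_mem hS).mono fun x hx => ?_)
    simp only [Real.norm_of_nonneg (hA0 x hx), hAp x hx]
  have hpt : ∀ x ∈ expShell N τ, ‖u x * (Δ (Δ φ) x - μ / ‖x‖ ^ 4 * φ x)‖ ≤ C * (A x * B) := by
    intro x hx
    have hx0 := ne_zero_of_mem_closedExteriorDomain (hsub (hSΩ hx))
    have hr : 0 < ‖x‖ := norm_pos_iff.2 hx0
    have ht := (mem_expShell_iff_log hx0).1 hx
    have ht1 : 1 ≤ Real.log ‖x‖ := hτ.trans ht.1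
    have hest := hC τ hτ _ ht
    have hmain := mul_le_rpow_mul_exp (U := |u x|) (n' := N) hp hθ hn (by rw [ha]; ring) ha0
      (abs_nonneg _) (abs_nonneg G') (hg.nonneg (zero_le_one.trans ht1)) (hGg _ ht1)
      (smoothCutoff_nonneg (Real.log ‖x‖ - τ)) (smoothCutoff_le_one _) ht.1 hτ0.le
    rw [hL x (hSΩ hx), norm_mul, Real.norm_eq_abs, Real.norm_eq_abs, radialProfile, abs_mul,
      abs_of_nonneg (Real.rpow_nonneg hr.le _), rpow_eq_exp_mul_log hr]
    have hAx : A x = (Real.exp (σ * Real.log ‖x‖) * |u x| ^ p * (Real.exp (-a * Real.log ‖x‖) *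
        (g (Real.log ‖x‖) * smoothCutoff (Real.log ‖x‖ - τ) ^ (n + 4)))) ^ (1 / p) := by
      simp only [hA, hρφ, hφ, radialProfile, truncated, rpow_eq_exp_mul_log hr]
    rw [hAx]
    calc _ ≤ |u x| * (Real.exp (-(a + 4) * Real.log ‖x‖) *
          (C * (g (Real.log ‖x‖) * smoothCutoff (Real.log ‖x‖ - τ) ^ n))) := by gcongr
      _ = C * (|u x| * (Real.exp (-(a + 4) * Real.log ‖x‖) *
          (g (Real.log ‖x‖) * smoothCutoff (Real.log ‖x‖ - τ) ^ n))) := by ring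
      _ ≤ _ := mul_le_mul_of_nonneg_left hmain hC0
  have hAi : IntegrableOn A (expShell N τ) :=
    hAm.integrable (by simpa using hp.le)
  have hint : ∫ x in exteriorDomain N, u x * (Δ (Δ φ) x - μ / ‖x‖ ^ 4 * φ x) ≤
      C * ∫ x in expShell N τ, A x * B := by
    -- Below the shell the test profile equals the kernel, beyond it is zero; both are annihilated
    -- by the operator.
    rw [setIntegral_eq_of_subset_of_forall_sdiff_eq_zero hΩ hSΩ]
    · refine (le_abs_self _).trans ?_
      rw [← Real.norm_eq_abs, ← integral_const_mul]
      exact norm_integral_le_of_norm_le ((hAi.mul_const B).const_mul C)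
        ((ae_restrict_mem hS).mono hpt)
    · intro x hx
      have hx0 := ne_zero_of_mem_closedExteriorDomain (hsub hx.1)
      have hm : n + 4 ≠ 0 := by simp
      rw [hL x hx.1, radialProfile, hg.emdenFowlerOp_truncated_sub_of_notMem hm
        (fun h => hx.2 ((mem_expShell_iff_log hx0).2 h)), mul_zero, mul_zero]
  have hhol := integral_mul_le_Lp_mul_Lq_of_nonneg hpq
    ((ae_restrict_mem hS).mono hA0) (Filter.Eventually.of_forall fun _ => hB0) hAm
    (memLp_const (μ := volume.restrict (expShell N τ)) B)
  rw [setIntegral_congr_fun hS hAp, setIntegral_const, smul_eq_mul] at hhol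
  have hBq : B ^ q = G * Real.exp (-N * τ) := by
    rw [hB, Real.mul_rpow (by positivity) (by positivity), ← Real.rpow_mul (abs_nonneg _),
      ← Real.exp_mul, mul_assoc (-(N : ℝ) * τ), hqinv, Real.rpow_one, mul_one]
  have hfin : volume.real (expShell N τ) * B ^ q ≤ Real.exp N * V * G := by
    rw [hBq]
    calc volume.real (expShell N τ) * (G * Real.exp (-N * τ))
        ≤ (Real.exp ((τ + 1) * N) * V) * (G * Real.exp (-N * τ)) := by
          gcongr
          exact volume_real_expShell_le N τ
      _ = (Real.exp ((τ + 1) * N) * Real.exp (-N * τ)) * V * G := by ring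
      _ = _ := by rw [← Real.exp_add]; ring_nf
  have hI0 : 0 ≤ ∫ x in expShell N τ, ρφ x :=
    setIntegral_nonneg hS fun x hx => hρφ0 x (hSΩ hx)
  calc _ ≤ C * ∫ x in expShell N τ, A x * B := hint
    _ ≤ C * ((∫ x in expShell N τ, ρφ x) ^ (1 / p) *
          (volume.real (expShell N τ) * B ^ q) ^ (1 / q)) := by gcongr
    _ ≤ C * ((∫ x in expShell N τ, ρφ x) ^ (1 / p) * (Real.exp N * V * G) ^ (1 / q)) := by
        gcongr
    _ = _ := by ring

end WeakSolution

/-! ### Nonexistence of weak solutions -/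

section Nonexistence

variable {N : ℕ} {μ σ p : ℝ} {f u : EuclideanSpace ℝ (Fin N) → ℝ}

theorem setIntegral_mul_profile_pos {g : ℝ → ℝ} {θ : ℝ} {m : ℕ} (hN : 5 ≤ N)
    (hg : IsNavierKernel (((N : ℝ) - 4) / 2) (N / 2) μ θ g)
    (hf : LocallyIntegrableOn f (closedExteriorDomain N) volume)
    (hpos : ∀ᵐ x ∂(volume.restrict (exteriorDomain N)), 0 < f x) :
    0 < ∫ x in expShell N 0, f x * radialProfile (((N : ℝ) - 4) / 2) (truncated g m 1) x := by
  have hS := measurableSet_expShell N 0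
  have hSc : expShell N 0 ⊆ closedExteriorDomain N := fun x hx => by
    have h := (mem_expShell.1 hx).1
    rwa [Real.exp_zero] at h
  have hScpt : IsCompact (expShell N 0) :=
    (isCompact_closedBall (0 : EuclideanSpace ℝ (Fin N)) (Real.exp (0 + 1))).of_isClosed_subset
      ((isClosed_le continuous_const continuous_norm).inter
        (isClosed_le continuous_norm continuous_const)) (expShell_subset_closedBall N 0)
  have hint : IntegrableOn (fun x => f x * radialProfile (((N : ℝ) - 4) / 2) (truncated g m 1) x)
      (expShell N 0) :=
    (hf.integrableOn_compact_subset hSc hScpt).mul_continuousOn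
      (continuousOn_radialProfile (contDiff_truncated hg.contDiff m 1) hSc) hScpt
  let U : Set (EuclideanSpace ℝ (Fin N)) := {x | 1 < ‖x‖} ∩ {x | ‖x‖ < Real.exp 1}
  have hU : IsOpen U := (isOpen_lt continuous_const continuous_norm).inter
    (isOpen_lt continuous_norm continuous_const)
  have hmemU : ∀ x, x ∈ U ↔ 1 < ‖x‖ ∧ ‖x‖ < Real.exp 1 := fun x => Iff.rfl
  have hUΩ : U ⊆ exteriorDomain N := fun x hx => ((hmemU x).1 hx).1
  have hUS : U ⊆ expShell N 0 := fun x hx => by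
    have := (hmemU x).1 hx
    rw [mem_expShell, Real.exp_zero, zero_add]
    exact ⟨this.1.le, this.2.le⟩
  have hUne : U.Nonempty := by
    have : Nontrivial (EuclideanSpace ℝ (Fin N)) :=
      have : Nonempty (Fin N) := ⟨⟨0, by omega⟩⟩
      inferInstance
    obtain ⟨x, hx⟩ := exists_norm_eq (EuclideanSpace ℝ (Fin N)) (c := 2) (by norm_num)
    refine ⟨x, (hmemU x).2 ⟨by rw [hx]; norm_num, by rw [hx]; linarith [Real.exp_one_gt_d9]⟩⟩
  -- The closed shell contains the unit sphere, where nothing is known about f; it is a null set.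
  have hposc : ∀ᵐ x ∂(volume.restrict (expShell N 0)), 0 < f x := by
    have hsphere : volume (Metric.sphere (0 : EuclideanSpace ℝ (Fin N)) 1) = 0 :=
      Measure.addHaar_sphere_of_ne_zero _ _ one_ne_zero
    rw [ae_restrict_iff' hS]
    rw [ae_restrict_iff' (isOpen_exteriorDomain N).measurableSet] at hpos
    filter_upwards [hpos, compl_mem_ae_iff.2 hsphere] with x h1 h2 hx
    refine h1 (mem_exteriorDomain.2 (lt_of_le_of_ne (mem_closedExteriorDomain.1 (hSc hx)) ?_))
    intro he
    exact h2 (by simp [← he])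
  rw [setIntegral_pos_iff_support_of_nonneg_ae _ hint]
  · have hsub : (U ∩ {x | 0 < f x} : Set _) ⊆ Function.support (fun x => f x *
        radialProfile (((N : ℝ) - 4) / 2) (truncated g m 1) x) ∩ expShell N 0 := by
      rintro x ⟨hx, hfx⟩
      refine ⟨?_, hUS hx⟩
      have h1 := (hmemU x).1 hx
      have hx0 := ne_zero_of_mem_closedExteriorDomain (hSc (hUS hx))
      rw [Function.mem_support, radialProfile_truncated_eq hx0 h1.2.le]
      have hr : 0 < ‖x‖ := norm_pos_iff.2 hx0
      have h2 : 0 < f x := hfx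
      have h3 := hg.pos _ (Real.log_pos h1.1)
      have h4 := Real.rpow_pos_of_pos hr (-(((N : ℝ) - 4) / 2))
      exact (mul_pos h2 (mul_pos h4 h3)).ne'
    refine lt_of_lt_of_le ?_ (measure_mono hsub)
    have hae : (U ∩ {x | 0 < f x} : Set _) =ᵐ[volume] U := by
      rw [ae_restrict_iff' (isOpen_exteriorDomain N).measurableSet] at hpos
      filter_upwards [hpos] with x hx
      exact propext ⟨fun h => h.1, fun h => ⟨h, hx (hUΩ h)⟩⟩
    rw [measure_congr hae]
    exact hU.measure_pos _ hUne
  · filter_upwards [hposc, ae_restrict_mem hS] with x h1 h2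
    exact mul_nonneg h1.le (radialProfile_truncated_nonneg hg (hSc h2))

/-- The shell integrals are bounded below while the full integrals are bounded above, which is
impossible over infinitely many disjoint shells. -/
theorem not_isWeakSolution_of_isNavierKernel {g : ℝ → ℝ} {θ : ℝ} (hN : 5 ≤ N)
    (hg : IsNavierKernel (((N : ℝ) - 4) / 2) (N / 2) μ θ g) (hp : 1 < p)
    (hθ : (((N : ℝ) - 4) / 2 + θ) * (p - 1) ≤ σ + 4)
    (hf : LocallyIntegrableOn f (closedExteriorDomain N) volume)
    (hpos : ∀ᵐ x ∂(volume.restrict (exteriorDomain N)), 0 < f x) :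
    ¬ IsWeakSolution μ σ p f u := by
  intro hu
  have hp0 : 0 < p := by linarith
  obtain ⟨n, hn⟩ : ∃ n : ℕ, (n : ℝ) + 4 ≤ n * p := by
    obtain ⟨n, hn⟩ := exists_nat_ge (4 / (p - 1))
    refine ⟨n, ?_⟩
    rw [div_le_iff₀ (by linarith)] at hn
    linarith
  obtain ⟨M, hM0, hM⟩ := exists_source_mul_profile_estimate hN hg hp hθ hn
  set a : ℝ := ((N : ℝ) - 4) / 2 with ha
  have hm : n + 4 ≠ 0 := by simp
  set Φ : ℝ → EuclideanSpace ℝ (Fin N) → ℝ := fun τ => radialProfile a (truncated g (n + 4) τ)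
    with hΦ
  set ρ : EuclideanSpace ℝ (Fin N) → ℝ := fun x => ‖x‖ ^ σ * |u x| ^ p with hρ
  have hρ0 : ∀ x, 0 ≤ ρ x := fun x => by positivity
  have hΩ := (isOpen_exteriorDomain N).measurableSet
  have hsub := exteriorDomain_subset_closedExteriorDomain N
  set I : ℝ → ℝ := fun τ => ∫ x in exteriorDomain N, ρ x * Φ τ x with hI
  set b : ℝ → ℝ := fun τ => ∫ x in expShell N τ, ρ x * Φ τ x with hb
  set F : ℝ := ∫ x in expShell N 0, f x * Φ 1 x with hF
  have hFpos : 0 < F := setIntegral_mul_profile_pos hN hg hf hpos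
  have hρφi : ∀ τ, IntegrableOn (fun x => ρ x * Φ τ x) (exteriorDomain N) := fun τ =>
    integrableOn_mul_radialProfile_truncated (fun K => hu.integrableOn_source hp) hg.contDiff hm
  have hfφi : ∀ τ, IntegrableOn (fun x => f x * Φ τ x) (exteriorDomain N) := fun τ =>
    integrableOn_mul_radialProfile_truncated
      (fun K hK hKs => hf.integrableOn_compact_subset hKs hK) hg.contDiff hm
  have hΦ0 : ∀ τ, ∀ x ∈ exteriorDomain N, 0 ≤ Φ τ x := fun τ x hx =>
    radialProfile_truncated_nonneg hg (hsub hx)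
  -- On 1 ≤ ‖x‖ ≤ e no truncation with τ ≥ 1 is active, so F is a lower bound independent of τ.
  have hFle : ∀ τ, 1 ≤ τ → F ≤ ∫ x in exteriorDomain N, f x * Φ τ x := by
    intro τ hτ
    have hsphere : volume (Metric.sphere (0 : EuclideanSpace ℝ (Fin N)) 1) = 0 :=
      Measure.addHaar_sphere_of_ne_zero _ _ one_ne_zero
    have hae : (expShell N 0 : Set _) =ᵐ[volume]
        (expShell N 0 ∩ exteriorDomain N : Set _) := by
      filter_upwards [compl_mem_ae_iff.2 hsphere] with x hx
      refine propext ⟨fun h => ⟨h, mem_exteriorDomain.2 (lt_of_le_of_ne ?_ fun he => ?_)⟩,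
        fun h => h.1⟩
      · simpa using (mem_expShell.1 h).1
      · exact hx (by simp [← he])
    have hS := (measurableSet_expShell N 0).inter hΩ
    rw [hF, setIntegral_congr_set hae]
    calc ∫ x in expShell N 0 ∩ exteriorDomain N, f x * Φ 1 x
        = ∫ x in expShell N 0 ∩ exteriorDomain N, f x * Φ τ x := by
          refine setIntegral_congr_fun hS fun x hx => ?_
          have hx0 := ne_zero_of_mem_closedExteriorDomain (hsub hx.2)
          have h1 := (mem_expShell.1 hx.1).2
          rw [zero_add] at h1
          simp only [hΦ]
          rw [radialProfile_truncated_eq hx0 h1, radialProfile_truncated_eq hx0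
            (h1.trans (Real.exp_le_exp.2 hτ))]
      _ ≤ _ := by
          refine setIntegral_mono_set (hfφi τ) ?_ (inter_subset_right.eventuallyLE)
          filter_upwards [hpos, ae_restrict_mem hΩ] with x h1 h2
          exact mul_nonneg h1.le (hΦ0 τ x h2)
  have hbI : ∀ τ, 1 ≤ τ → b τ ≤ I τ := fun τ hτ =>
    setIntegral_mono_set (hρφi τ)
      ((ae_restrict_mem hΩ).mono fun x hx => mul_nonneg (hρ0 x) (hΦ0 τ x hx))
      (expShell_subset_exteriorDomain N (by linarith)).eventuallyLE
  have hb0 : ∀ τ, 1 ≤ τ → 0 ≤ b τ := fun τ hτ =>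
    setIntegral_nonneg (measurableSet_expShell N τ) fun x hx =>
      mul_nonneg (hρ0 x) (hΦ0 τ x (expShell_subset_exteriorDomain N (by linarith) hx))
  have hkey : ∀ τ, 1 ≤ τ → I τ + F ≤ M * b τ ^ (1 / p) := fun τ hτ => by
    have h1 : I τ + (∫ x in exteriorDomain N, f x * Φ τ x) ≤ M * b τ ^ (1 / p) := hM f u hu τ hτ
    linarith [hFle τ hτ]
  have hIle : ∀ τ, 1 ≤ τ → I τ ≤ M ^ (p / (p - 1)) := fun τ hτ => by
    have hI0 : 0 ≤ I τ := (hb0 τ hτ).trans (hbI τ hτ)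
    refine le_rpow_of_le_mul_rpow hp hI0 hM0 ?_
    have h1 : b τ ^ (1 / p) ≤ I τ ^ (1 / p) :=
      Real.rpow_le_rpow (hb0 τ hτ) (hbI τ hτ) (by positivity)
    have h2 := mul_le_mul_of_nonneg_left h1 hM0
    linarith [hkey τ hτ]
  have hMpos : 0 < M := by
    have h1 := hkey 1 le_rfl
    have hI0 : 0 ≤ I 1 := (hb0 1 le_rfl).trans (hbI 1 le_rfl)
    rcases hM0.eq_or_lt with h | h
    · rw [← h, zero_mul] at h1
      linarith
    · exact h
  -- Dropping I ≥ 0 leaves F ≤ M b^(1/p): every shell carries a fixed amount.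
  have hblow : ∀ τ, 1 ≤ τ → (F / M) ^ p ≤ b τ := fun τ hτ => by
    have hI0 : 0 ≤ I τ := (hb0 τ hτ).trans (hbI τ hτ)
    have h1 : F / M ≤ b τ ^ (1 / p) := by
      rw [div_le_iff₀' hMpos]
      linarith [hkey τ hτ]
    have h2 := Real.rpow_le_rpow (by positivity) h1 hp0.le
    rwa [← Real.rpow_mul (hb0 τ hτ), one_div_mul_cancel hp0.ne', Real.rpow_one] at h2
  set c : ℝ := (F / M) ^ p with hc
  have hcpos : 0 < c := Real.rpow_pos_of_pos (by positivity) _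
  -- The accumulated integral uses the untruncated kernel, so that contributions from different τ
  -- add up; it is still at most I.
  let R : ℝ → Set (EuclideanSpace ℝ (Fin N)) := fun τ => exteriorDomain N ∩ {x | ‖x‖ < Real.exp τ}
  have hmemR : ∀ τ x, x ∈ R τ ↔ x ∈ exteriorDomain N ∧ ‖x‖ < Real.exp τ := fun τ x => Iff.rfl
  have hRm : ∀ τ, MeasurableSet (R τ) := fun τ =>
    hΩ.inter (isOpen_lt continuous_norm continuous_const).measurableSet
  have hRφ : ∀ τ, EqOn (fun x => ρ x * radialProfile a g x) (fun x => ρ x * Φ τ x) (R τ) := by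
    intro τ x hx
    have := (hmemR τ x).1 hx
    simp only [hΦ]
    rw [radialProfile_truncated_eq (ne_zero_of_mem_closedExteriorDomain (hsub this.1)) this.2.le]
  have hRi : ∀ τ, IntegrableOn (fun x => ρ x * radialProfile a g x) (R τ) := fun τ =>
    ((hρφi τ).mono_set inter_subset_left).congr_fun (hRφ τ).symm (hRm τ)
  have hh0 : ∀ x ∈ exteriorDomain N, 0 ≤ ρ x * radialProfile a g x := fun x hx =>
    mul_nonneg (hρ0 x) (mul_nonneg (Real.rpow_nonneg (norm_nonneg _) _)
      (hg.nonneg (Real.log_nonneg (mem_exteriorDomain.1 hx).le)))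
  set J : ℝ → ℝ := fun τ => ∫ x in R τ, ρ x * radialProfile a g x with hJ
  have hJI : ∀ τ, J τ ≤ I τ := fun τ => by
    rw [hJ]
    simp only
    rw [setIntegral_congr_fun (hRm τ) (hRφ τ)]
    exact setIntegral_mono_set (hρφi τ)
      ((ae_restrict_mem hΩ).mono fun x hx => mul_nonneg (hρ0 x) (hΦ0 τ x hx))
      inter_subset_left.eventuallyLE
  -- The shell has logarithmic width 1; a step of 2 keeps it inside the next open region.
  have hJstep : ∀ τ, 1 ≤ τ → J τ + c ≤ J (τ + 2) := fun τ hτ => by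
    have hSR : expShell N τ ⊆ R (τ + 2) := fun x hx =>
      (hmemR _ x).2 ⟨expShell_subset_exteriorDomain N (by linarith) hx,
        (mem_expShell.1 hx).2.trans_lt (Real.exp_lt_exp.2 (by linarith))⟩
    have hRR : R τ ⊆ R (τ + 2) := fun x hx =>
      (hmemR _ x).2 ⟨((hmemR _ x).1 hx).1,
        ((hmemR _ x).1 hx).2.trans (Real.exp_lt_exp.2 (by linarith))⟩
    have hdisj : Disjoint (R τ) (expShell N τ) := disjoint_left.2 fun x h1 h2 =>
      absurd ((hmemR _ x).1 h1).2 (not_lt.2 (mem_expShell.1 h2).1)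
    have hS := measurableSet_expShell N τ
    have hbS : b τ ≤ ∫ x in expShell N τ, ρ x * radialProfile a g x :=
      setIntegral_mono_on ((hρφi τ).mono_set (expShell_subset_exteriorDomain N (by linarith)))
        ((hRi (τ + 2)).mono_set hSR) hS fun x hx =>
        mul_le_mul_of_nonneg_left (radialProfile_truncated_le hg
          (hsub (expShell_subset_exteriorDomain N (by linarith) hx))) (hρ0 x)
    have hun := setIntegral_union hdisj hS (hRi τ) ((hRi (τ + 2)).mono_set hSR)
    have hmono : ∫ x in R τ ∪ expShell N τ, ρ x * radialProfile a g x ≤ J (τ + 2) :=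
      setIntegral_mono_set (hRi (τ + 2))
        ((ae_restrict_mem (hRm _)).mono fun x hx => hh0 x ((hmemR _ x).1 hx).1)
        (union_subset hRR hSR).eventuallyLE
    have := hblow τ hτ
    have hJτ : J τ = ∫ x in R τ, ρ x * radialProfile a g x := rfl
    linarith
  have hJlow : ∀ k : ℕ, k * c ≤ J (1 + 2 * k) := by
    intro k
    induction k with
    | zero =>
      simp only [Nat.cast_zero, zero_mul]
      exact setIntegral_nonneg (hRm _) fun x hx => hh0 x ((hmemR _ x).1 hx).1
    | succ k ih =>
      have h1 := hJstep (1 + 2 * k) (by linarith [(Nat.cast_nonneg k : (0 : ℝ) ≤ k)])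
      push_cast
      rw [show (1 : ℝ) + 2 * (k + 1) = 1 + 2 * k + 2 by ring]
      linarith
  obtain ⟨k, hk⟩ := exists_nat_gt (M ^ (p / (p - 1)) / c)
  rw [div_lt_iff₀ hcpos] at hk
  have h1 : (1 : ℝ) ≤ 1 + 2 * k := by linarith [(Nat.cast_nonneg k : (0 : ℝ) ≤ k)]
  linarith [hJlow k, hJI (1 + 2 * k), hIle (1 + 2 * k) h1]

theorem not_exists_isWeakSolution (hN : 5 ≤ N) (hσ : -4 < σ)
    (h : (0 < μ ∧ μ ≤ hardyRellichConst N ∧ 1 < p ∧ p < 1 + (σ + 4) / muN N μ) ∨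
      (0 < μ ∧ μ < hardyRellichConst N ∧ p = 1 + (σ + 4) / muN N μ))
    (hf : LocallyIntegrableOn f (closedExteriorDomain N) volume)
    (hpos : ∀ᵐ x ∂(volume.restrict (exteriorDomain N)), 0 < f x) :
    ¬ ∃ u : EuclideanSpace ℝ (Fin N) → ℝ, IsWeakSolution μ σ p f u := by
  rintro ⟨u, hu⟩
  have hμ : 0 < μ ∧ μ ≤ hardyRellichConst N := by
    rcases h with h | h
    · exact ⟨h.1, h.2.1⟩
    · exact ⟨h.1, h.2.1.le⟩
  obtain ⟨s₁, s₂, hs, hmu, hlt⟩ := exists_isIndicialPair hN hμ.1 hμ.2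
  have hm0 : 0 < muN N μ := by rw [hmu]; linarith [hs.a_pos, hs.s₁_nonneg]
  have hp : 1 < p := by
    rcases h with h | h
    · exact h.2.2.1
    · have : 0 < (σ + 4) / muN N μ := div_pos (by linarith) hm0
      linarith [h.2.2]
  have hple : muN N μ * (p - 1) ≤ σ + 4 := by
    rw [mul_comm, ← le_div_iff₀ hm0]
    rcases h with h | h <;> linarith [h.2.2]
  rcases hs.s₁_nonneg.eq_or_lt with h0 | h0
  · subst h0
    have hsub : p < 1 + (σ + 4) / muN N μ := by
      rcases h with h | h
      · exact h.2.2.2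
      · exact absurd (hlt h.2.1) (lt_irrefl _)
    have hgap : muN N μ < (σ + 4) / (p - 1) := by
      rw [lt_div_iff₀ (by linarith), mul_comm, ← lt_div_iff₀ hm0]
      linarith
    -- Here θ = (σ + 4)/(p - 1) - μ_N, the whole gap left by strict subcriticality.
    obtain ⟨g, hg⟩ := hs.exists_isNavierKernel_of_zero (sub_pos.2 hgap)
    refine not_isWeakSolution_of_isNavierKernel hN hg hp ?_ hf hpos hu
    rw [hmu, add_zero, add_sub_cancel, div_mul_cancel₀ _ (by linarith)]
  · obtain ⟨g, hg⟩ := hs.exists_isNavierKernel_of_pos h0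
    refine not_isWeakSolution_of_isNavierKernel hN hg hp ?_ hf hpos hu
    rwa [← hmu]

end Nonexistence

/-! ### Existence above the critical exponent -/

/-- A combination of decaying exponentials that satisfies the Navier conditions at `0` and on which
`(D² - a²)(D² - b²) - μ` is positive. -/
theorem IsIndicialPair.exists_positive_residual {a b μ s₁ s₂ k : ℝ}
    (h : IsIndicialPair a b μ s₁ s₂) (h1 : s₁ < k) (h2 : k < s₂) :
    ∃ w : ℝ → ℝ, ∃ c C : ℝ, ContDiff ℝ ∞ w ∧ w 0 = 0 ∧
      shiftDeriv (-b) (shiftDeriv a w) 0 = 0 ∧ 0 < c ∧ 0 ≤ C ∧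
      (∀ t, emdenFowlerOp a b w t - μ * w t = c * Real.exp (-k * t)) ∧
      ∀ t, 0 ≤ t → |w t| ≤ C * Real.exp (-s₁ * t) := by
  obtain ⟨ha, hb, hs0, h3, h4, h5, h6⟩ := id h
  have h12 := h.s₁_lt_s₂
  -- q(s) is the factor by which the second Navier operator acts on exp(-st); β makes the
  -- combination -exp(-kt) + (1 - β) exp(-s₁t) + β exp(-s₂t) satisfy that condition.
  let q : ℝ → ℝ := fun s => (-s - a) * (-s + b)
  have hq : q s₂ - q s₁ ≠ 0 := by
    have : q s₂ - q s₁ = (s₂ - s₁) * (s₂ + s₁ - 2) := by simp only [q, hb]; ring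
    rw [this]
    exact (mul_pos (by linarith) (by linarith)).ne'
  set β := (q k - q s₁) / (q s₂ - q s₁) with hβ
  have hβe : β * (q s₂ - q s₁) = q k - q s₁ := div_mul_cancel₀ _ hq
  refine ⟨threeExp (-k) (-s₁) (-s₂) (-1) (1 - β) β, (k ^ 2 - s₁ ^ 2) * (s₂ ^ 2 - k ^ 2),
    1 + |1 - β| + |β|, contDiff_threeExp _ _ _ _ _ _, ?_, ?_, ?_, by positivity, ?_, ?_⟩
  · simp only [threeExp, mul_zero, Real.exp_zero]
    ring
  · simp only [shiftDeriv_threeExp, threeExp, mul_zero, Real.exp_zero]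
    simp only [q] at hβe
    linear_combination hβe
  -- Between s₁ and s₂ the symbol minus μ is negative, so the coefficient -1 of exp(-kt) yields a
  -- positive residual; the other two exponentials are annihilated.
  · exact mul_pos (by nlinarith) (by nlinarith)
  · intro t
    rw [emdenFowlerOp_threeExp, h.symbol_eq, h.symbol_eq, h.symbol_eq]
    simp only [threeExp]
    ring
  · intro t ht
    have e1 : Real.exp (-k * t) ≤ Real.exp (-s₁ * t) := Real.exp_le_exp.2 (by nlinarith)
    have e2 : Real.exp (-s₂ * t) ≤ Real.exp (-s₁ * t) := Real.exp_le_exp.2 (by nlinarith)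
    calc |threeExp (-k) (-s₁) (-s₂) (-1) (1 - β) β t|
        ≤ 1 * Real.exp (-k * t) + |1 - β| * Real.exp (-s₁ * t) + |β| * Real.exp (-s₂ * t) := by
          refine (abs_add_three _ _ _).trans ?_
          simp [abs_mul]
      _ ≤ 1 * Real.exp (-s₁ * t) + |1 - β| * Real.exp (-s₁ * t) + |β| * Real.exp (-s₁ * t) := by
          gcongr
      _ = _ := by ring

theorem shiftDeriv_const_mul {w : ℝ → ℝ} (hw : ContDiff ℝ ∞ w) (ε l : ℝ) :
    shiftDeriv l (fun t => ε * w t) = fun t => ε * shiftDeriv l w t := by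
  funext t
  simp only [shiftDeriv]
  rw [deriv_const_mul _ (hw.differentiable (by simp) t)]
  ring

theorem emdenFowlerOp_const_mul {w : ℝ → ℝ} (hw : ContDiff ℝ ∞ w) (ε a b t : ℝ) :
    emdenFowlerOp a b (fun t => ε * w t) t = ε * emdenFowlerOp a b w t := by
  have h1 := hw.shiftDeriv a
  have h2 := h1.shiftDeriv (-b)
  have h3 := h2.shiftDeriv b
  simp only [emdenFowlerOp, shiftDeriv_const_mul hw, shiftDeriv_const_mul h1,
    shiftDeriv_const_mul h2, shiftDeriv_const_mul h3]

/-- Since p > 1, ε^p is negligible against ε; adding 1 to C^p covers C = 0 and makes the inequality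
strict. -/
theorem exists_pos_mul_rpow_lt_mul {p : ℝ} (hp : 1 < p) {C c : ℝ} (hC : 0 ≤ C) (hc : 0 < c) :
    ∃ ε : ℝ, 0 < ε ∧ (ε * C) ^ p < ε * c := by
  have hp1 : 0 < p - 1 := by linarith
  have hD : 0 < C ^ p + 1 := by positivity
  refine ⟨(c / (C ^ p + 1)) ^ (1 / (p - 1)), by positivity, ?_⟩
  set ε := (c / (C ^ p + 1)) ^ (1 / (p - 1)) with hε
  have hε0 : 0 < ε := by positivity
  have e : ε ^ (p - 1) = c / (C ^ p + 1) := by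
    rw [hε, ← Real.rpow_mul (by positivity), one_div_mul_cancel hp1.ne', Real.rpow_one]
  have e' : ε ^ p = ε * (c / (C ^ p + 1)) := by
    rw [← e, ← Real.rpow_one_add' hε0.le (by linarith)]
    ring_nf
  rw [Real.mul_rpow hε0.le hC, e', mul_assoc]
  refine mul_lt_mul_of_pos_left ?_ hε0
  rw [div_mul_eq_mul_div, div_lt_iff₀ hD]
  nlinarith

theorem exists_isSmoothSolution {N : ℕ} (hN : 5 ≤ N) {σ μ p : ℝ} (hσ : -4 < σ) (h0 : 0 < μ)
    (h1 : μ ≤ hardyRellichConst N) (hp : 1 + (σ + 4) / muN N μ < p) :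
    ∃ f : EuclideanSpace ℝ (Fin N) → ℝ,
      LocallyIntegrableOn f (closedExteriorDomain N) volume ∧
      (∀ x ∈ exteriorDomain N, 0 < f x) ∧
      ∃ u : EuclideanSpace ℝ (Fin N) → ℝ, IsSmoothSolution μ σ p f u := by
  obtain ⟨s₁, s₂, hs, hmu, -⟩ := exists_isIndicialPair hN h0 h1
  set a : ℝ := ((N : ℝ) - 4) / 2 with ha
  have hm0 : 0 < muN N μ := by rw [hmu]; linarith [hs.a_pos, hs.s₁_nonneg]
  have hp1 : 1 < p := by
    have : 0 < (σ + 4) / muN N μ := div_pos (by linarith) hm0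
    linarith
  have hp0 : 0 < p := by linarith
  have hδ : 0 < (a + s₁) * (p - 1) - (σ + 4) := by
    have : (σ + 4) / muN N μ < p - 1 := by linarith
    rw [div_lt_iff₀ hm0, hmu] at this
    linarith
  -- k < s₂ gives the sign of the residual. The other bound says that ‖x‖^(-(a+4+k)) decays no
  -- faster than ‖x‖^(σ-(a+s₁)p), and supercriticality leaves room for it above s₁.
  obtain ⟨k, hk1, hk2⟩ := exists_between (lt_min hs.s₁_lt_s₂ (lt_add_of_pos_right s₁ hδ))
  obtain ⟨v, c, C, hv, hv0, hv2, hc, hC, hres, hvC⟩ :=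
    hs.exists_positive_residual hk1 (hk2.trans_le (min_le_left _ _))
  have hk3 : k < s₁ + ((a + s₁) * (p - 1) - (σ + 4)) := hk2.trans_le (min_le_right _ _)
  obtain ⟨ε, hε, hεlt⟩ := exists_pos_mul_rpow_lt_mul hp1 hC hc
  set w : ℝ → ℝ := fun t => ε * v t with hw
  have hwc : ContDiff ℝ ∞ w := contDiff_const.mul hv
  set u : EuclideanSpace ℝ (Fin N) → ℝ := radialProfile a w with hu
  set L : EuclideanSpace ℝ (Fin N) → ℝ :=
    radialProfile (a + 4) (fun t => ε * (c * Real.exp (-k * t))) with hL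
  have hLu : ∀ x ∈ closedExteriorDomain N, Δ (Δ u) x - μ / ‖x‖ ^ 4 * u x = L x := by
    intro x hx
    have hx0 := ne_zero_of_mem_closedExteriorDomain hx
    rw [laplacian_laplacian_radialProfile_eq hwc hx0, ← ha, div_eq_mul_one_div μ, mul_assoc, hu,
      ← radialProfile_add_four a w hx0]
    simp only [radialProfile, hL, ← hres]
    rw [emdenFowlerOp_const_mul hv, hw]
    ring
  -- The equation holds by the choice of f; only the positivity of f needs the estimates.
  refine ⟨fun x => L x - ‖x‖ ^ σ * |u x| ^ p, ?_, ?_, u, ?_, ?_, ?_⟩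
  · refine ContinuousOn.locallyIntegrableOn ?_ (isClosed_closedExteriorDomain N).measurableSet
    refine (continuousOn_radialProfile (by fun_prop) subset_rfl).sub (ContinuousOn.mul ?_ ?_)
    · exact continuous_norm.continuousOn.rpow_const fun x hx =>
        Or.inl (norm_ne_zero_iff.2 (ne_zero_of_mem_closedExteriorDomain hx))
    · exact (continuousOn_radialProfile hwc subset_rfl).abs.rpow_const fun x _ => Or.inr hp0.le
  · intro x hx
    have hx0 := ne_zero_of_mem_closedExteriorDomain (exteriorDomain_subset_closedExteriorDomain N hx)
    have hr : 0 < ‖x‖ := norm_pos_iff.2 hx0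
    have ht : 0 ≤ Real.log ‖x‖ := Real.log_nonneg (mem_exteriorDomain.1 hx).le
    simp only [hL, hu, radialProfile, rpow_eq_exp_mul_log hr]
    set t := Real.log ‖x‖
    have hwt : |w t| ≤ ε * C * Real.exp (-s₁ * t) := by
      rw [hw, abs_mul, abs_of_pos hε, mul_assoc]
      exact mul_le_mul_of_nonneg_left (hvC t ht) hε.le
    rw [sub_pos, abs_mul, Real.abs_exp]
    calc Real.exp (σ * t) * (Real.exp (-a * t) * |w t|) ^ p
        ≤ Real.exp (σ * t) * (Real.exp (-a * t) * (ε * C * Real.exp (-s₁ * t))) ^ p := by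
          gcongr
      _ = (ε * C) ^ p * Real.exp ((σ - (a + s₁) * p) * t) := by
          rw [Real.mul_rpow (by positivity) (by positivity),
            Real.mul_rpow (by positivity) (by positivity), ← Real.exp_mul, ← Real.exp_mul,
            show (σ - (a + s₁) * p) * t = σ * t + -a * t * p + -s₁ * t * p by ring,
            Real.exp_add, Real.exp_add]
          ring
      _ < ε * c * Real.exp ((σ - (a + s₁) * p) * t) := by gcongr
      _ ≤ ε * c * Real.exp (-(a + 4) * t + -k * t) := by
          gcongr
          nlinarith
      _ = Real.exp (-(a + 4) * t) * (ε * (c * Real.exp (-k * t))) := by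
          rw [Real.exp_add]
          ring
  · exact contDiffOn_radialProfile a hwc
  · intro x hx
    rw [hLu x (exteriorDomain_subset_closedExteriorDomain N hx)]
    ring
  · refine navierBoundary_radialProfile_eq hwc (by simp [hw, hv0]) ?_
    rw [hw, shiftDeriv_const_mul hv, shiftDeriv_const_mul (hv.shiftDeriv _)]
    exact mul_eq_zero_of_right ε hv2

theorem mainTheorem3 (N : ℕ) (hN : 5 ≤ N) (σ : ℝ) (hσ : -4 < σ) (μ p : ℝ) :
    (((0 < μ ∧ μ ≤ hardyRellichConst N ∧ 1 < p ∧ p < 1 + (σ + 4) / muN N μ) ∨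
        (0 < μ ∧ μ < hardyRellichConst N ∧ p = 1 + (σ + 4) / muN N μ)) →
      ∀ f : EuclideanSpace ℝ (Fin N) → ℝ,
        LocallyIntegrableOn f (closedExteriorDomain N) volume →
        (∀ᵐ x ∂(volume.restrict (exteriorDomain N)), 0 < f x) →
        ¬ ∃ u : EuclideanSpace ℝ (Fin N) → ℝ, IsWeakSolution μ σ p f u) ∧
    ((0 < μ ∧ μ ≤ hardyRellichConst N ∧ 1 + (σ + 4) / muN N μ < p) →
      ∃ f : EuclideanSpace ℝ (Fin N) → ℝ,
        LocallyIntegrableOn f (closedExteriorDomain N) volume ∧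
        (∀ x ∈ exteriorDomain N, 0 < f x) ∧
        ∃ u : EuclideanSpace ℝ (Fin N) → ℝ, IsSmoothSolution μ σ p f u) :=
  ⟨fun h _ hf hpos => not_exists_isWeakSolution hN hσ h hf hpos,
    fun h => exists_isSmoothSolution hN hσ h.1 h.2.1 h.2.2⟩
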